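/- Let $f:\mathbb R^n\to\mathbb R$ be convex and $L$-smooth ($L>0$: $f$ is differentiable and $\|\nabla f(x)-\nabla f(y)\|_2\le L\|x-y\|_2$ for all $x,y$), let $x^*$ be a minimizer of $f$, $x^0\ne x^*$ and $R_0=\|x^0-x^*\|_2$. Let $\nabla f(x,\xi)$ (jointly measurable in $x$ and $\xi$) be a stochastic gradient with $\mathbb E_\xi[\nabla f(x,\xi)]=\nabla f(x)$ and $\mathbb E_\xi[\|\nabla f(x,\xi)-\nabla f(x)\|_2^2]\le\sigma^2$ for all $x$, where $\sigma\ge0$. Let $\beta\in(0,1)$, $C=\sqrt5$. The method clipped-SSTM with parameters $N$, $a$, $B$, $m_0,m_1,\dots$ sets $A_0=0$, $y^0=z^0=x^0$ and, for $k=0,\dots,N-1$, $$\alpha_{k+1}=\tfrac{k+2}{2aL},\quad A_{k+1}=A_k+\alpha_{k+1},\quad \lambda_{k+1}=\tfrac{B}{\alpha_{k+1}},\quad x^{k+1}=\tfrac{A_ky^k+\alpha_{k+1}z^k}{A_{k+1}},$$ $$g^k=\tfrac1{m_k}\sum_{i=1}^{m_k}\nabla f(x^{k+1},\xi_i^k),\quad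 z^{k+1}=z^k-\alpha_{k+1}\min\{1,\lambda_{k+1}/\|g^k\|_2\}\,g^k,\quad y^{k+1}=\tfrac{A_ky^k+\alpha_{k+1}z^{k+1}}{A_{k+1}},$$ where all samples $\xi_i^k$ are i.i.d. copies of $\xi$; the output is $y^N$ (a clipped zero vector is zero). It makes $\sum_{k=0}^{N-1}m_k$ oracle calls. For $N\ge1$ with $\ln\frac{4N}\beta\ge2$ choose $$B=\frac{CR_0}{8\ln\frac{4N}\beta},\qquad a=\max\Big\{a',\ \frac{\sigma N^{3/2}}{LR_0}\sqrt{\ln\tfrac{4N}\beta}\Big\},$$ $$a'=\max\Big\{1,\ \frac{16\ln\frac{4N}\beta}{C},\ 36\Big(2\ln\tfrac{4N}\beta+\sqrt{4\ln^2\tfrac{4N}\beta+2\ln\tfrac{4N}\beta}\Big)^2\Big\},$$ $$m_k=\left\lceil\max\Big\{1,\ \frac{6000\sigma^2\alpha_{k+1}^2N\ln\frac{4N}\beta}{C^2R_0^2},\ \frac{10368\sigma^2\alpha_{k+1}^2N}{C^2R_0^2}\Big\}\right\rceil .$$ Then there is a numerical constant $K>0$ (independent of $n$, $f$, the distribution of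 $\xi$, $L,\sigma,R_0,\beta,\varepsilon,N$) such that: 1. for every $N\ge 1$ with $\ln\frac{4N}{\beta}\ge2$, $m_k\le K$ for all $k=0,\dots,N$; 2. for every $\varepsilon>0$ there is $N_0\ge1$ with $\ln\frac{4N_0}\beta\ge2$ such that both $N_0$ and the number $\sum_{k=0}^{N_0-1}m_k$ of oracle calls of the run with $N=N_0$ are at most $$K\max\left\{1,\ \max\Big\{\sqrt{\frac{LR_0^2}{\varepsilon}},\frac{\sigma^2R_0^2}{\varepsilon^2}\Big\}\ln\frac{LR_0^2+\sigma R_0}{\varepsilon\beta}\right\},$$ and for every $N\ge N_0$ the method run for $N$ iterations (with the above parameters for this $N$) satisfies $f(y^N)-f(x^*)\le\varepsilon$ with probability at least $1-\beta$. -/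

import Mathlib

open MeasureTheory ProbabilityTheory

universe u v

namespace ClippedSSTM

noncomputable section

/-- `ℝⁿ` with the standard inner product and the Euclidean norm. -/
abbrev E (n : ℕ) : Type := EuclideanSpace ℝ (Fin n)

/-- `f` is `L`-smooth on `ℝⁿ`: differentiable with `L`-Lipschitz gradient. -/
def IsSmooth {n : ℕ} (L : ℝ) (f : E n → ℝ) : Prop :=
  Differentiable ℝ f ∧ ∀ x y : E n, ‖gradient f x - gradient f y‖ ≤ L * ‖x - y‖

/-- `G x ξ`, with `ξ` distributed according to `D`, is an unbiased stochastic gradient of `f`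
with variance uniformly bounded by `σ²`. No other moment or tail condition is imposed. -/
structure IsStochasticGradient {n : ℕ} {Ξ : Type u} [MeasurableSpace Ξ] (D : Measure Ξ)
    (f : E n → ℝ) (G : E n → Ξ → E n) (σ : ℝ) : Prop where
  measurable : Measurable (Function.uncurry G)
  integrable : ∀ x, Integrable (G x) D
  unbiased : ∀ x, ∫ s, G x s ∂D = gradient f x
  sq_integrable : ∀ x, Integrable (fun s => ‖G x s - gradient f x‖ ^ 2) D
  variance_le : ∀ x, ∫ s, ‖G x s - gradient f x‖ ^ 2 ∂D ≤ σ ^ 2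

/-- `clip(g, lam) = min {1, lam / ‖g‖} g` (equal to `0` for `g = 0`). -/
def clip {n : ℕ} (g : E n) (lam : ℝ) : E n := min 1 (lam / ‖g‖) • g

/-- The mini-batched stochastic gradient `(1/m) ∑ G x ξᵢ` over the first `m` samples. -/
def miniBatch {n : ℕ} {Ξ : Type u} (G : E n → Ξ → E n) (x : E n) (m : ℕ) (s : ℕ → Ξ) : E n :=
  (m : ℝ)⁻¹ • ∑ i ∈ Finset.range m, G x (s i)

/-- `α₀ = 0`, `α_{k+1} = (k + 2) / (2 a L)`. -/
def alpha (a L : ℝ) : ℕ → ℝ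
  | 0 => 0
  | k + 1 => ((k : ℝ) + 2) / (2 * a * L)

/-- `A₀ = 0`, `A_{k+1} = A_k + α_{k+1}`. -/
def bigA (a L : ℝ) : ℕ → ℝ
  | 0 => 0
  | k + 1 => bigA a L k + alpha a L (k + 1)

/-- The pair `(yᵏ, zᵏ)` of the method clipped-SSTM with stochastic gradient `G`, starting point
`x0`, batch sizes `m k`, stepsize parameter `a`, smoothness constant `L` and clipping parameter
`B`, where `s k i` is the `i`-th sample drawn in iteration `k`. -/
def iterates {n : ℕ} {Ξ : Type u} (G : E n → Ξ → E n) (a L B : ℝ) (m : ℕ → ℕ) (x0 : E n)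
    (s : ℕ → ℕ → Ξ) : ℕ → E n × E n
  | 0 => (x0, x0)
  | k + 1 =>
    let y := (iterates G a L B m x0 s k).1
    let z := (iterates G a L B m x0 s k).2
    let al := alpha a L (k + 1)
    let lam := B / al
    let x := (bigA a L (k + 1))⁻¹ • (bigA a L k • y + al • z)
    let g := clip (miniBatch G x (m k) (s k)) lam
    let z' := z - al • g
    ((bigA a L (k + 1))⁻¹ • (bigA a L k • y + al • z'), z')

/-- The output `yᴺ` after `N` iterations. -/
def output {n : ℕ} {Ξ : Type u} (G : E n → Ξ → E n) (a L B : ℝ) (m : ℕ → ℕ) (x0 : E n)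
    (s : ℕ → ℕ → Ξ) (N : ℕ) : E n :=
  (iterates G a L B m x0 s N).1

/-- The numerical constant `C = √5`. -/
def constC : ℝ := Real.sqrt 5

/-- `ln (4 N / β)`. -/
def logFactor (N : ℕ) (β : ℝ) : ℝ := Real.log (4 * N / β)

/-- `B = C R₀ / (8 ln (4 N / β))`. -/
def clipParam (R₀ β : ℝ) (N : ℕ) : ℝ := constC * R₀ / (8 * logFactor N β)

/-- `a' = max {1, 16 ℓ / C, 36 (2 ℓ + √(4 ℓ² + 2 ℓ))²}` with `ℓ = ln (4 N / β)`. -/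
def stepParam' (β : ℝ) (N : ℕ) : ℝ :=
  max 1 (max (16 * logFactor N β / constC)
    (36 * (2 * logFactor N β
      + Real.sqrt (4 * logFactor N β ^ 2 + 2 * logFactor N β)) ^ 2))

/-- `a = max {a', σ N^{3/2} √(ln (4 N / β)) / (L R₀)}`. -/
def stepParam (L σ R₀ β : ℝ) (N : ℕ) : ℝ :=
  max (stepParam' β N)
    (σ * (N : ℝ) ^ (3 / 2 : ℝ) / (L * R₀) * Real.sqrt (logFactor N β))

/-- The batch size `m_k` for a run of `N` iterations, rounded up to an integer:
`max {1, 6000 σ² α_{k+1}² N ln (4 N / β) / (C² R₀²), 10368 σ² α_{k+1}² N / (C² R₀²)}`. -/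
def batchSize (L σ R₀ β : ℝ) (N k : ℕ) : ℕ :=
  ⌈max (1 : ℝ)
    (max (6000 * σ ^ 2 * alpha (stepParam L σ R₀ β N) L (k + 1) ^ 2 * N * logFactor N β
        / (constC ^ 2 * R₀ ^ 2))
      (10368 * σ ^ 2 * alpha (stepParam L σ R₀ β N) L (k + 1) ^ 2 * N
        / (constC ^ 2 * R₀ ^ 2)))⌉₊

/-- `max {√(L R₀² / ε), σ² R₀² / ε²} · ln ((L R₀² + σ R₀) / (ε β))`. -/
def complexity (L σ R₀ β ε : ℝ) : ℝ :=
  max (Real.sqrt (L * R₀ ^ 2 / ε)) (σ ^ 2 * R₀ ^ 2 / ε ^ 2)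
    * Real.log ((L * R₀ ^ 2 + σ * R₀) / (ε * β))

end

end ClippedSSTM

/-! Write ℓ = ln(4N/β), R = R₀ and ρ = √5·R. One similar-triangles step increases the energy
A_k(f(yᵏ) - f(x*)) + ‖zᵏ - x*‖²/2 by at most a noise term in the error θ of the clipped gradient
(`similar_triangles_step`). So as long as the accumulated noise is at most 2R², the energy is at
most ρ²/2 and the iterates stay within ρ of x* (`energy_le`). There the true gradient is at most
half the clipping level (`norm_gradient_extrapolation_le`).

In this regime clipping bounds the noise, and its bias is quadratic in the batch error. A second
moment therefore suffices to control an exponential moment: each iteration multiplies E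
exp(4ℓ·noise/ρ²) by at most exp(ℓ/(100N)) (`lintegral_exp_clip_error_le`). Freezing the noise when
the regime is left avoids conditioning on a good event. Markov's inequality then gives failure
probability at most exp(ℓ/100 - 8ℓ/5) ≤ exp(-ℓ) ≤ β (`one_sub_exp_le_measureReal`).

The σ-dependent part of a forces σ²α²Nℓ ≤ (9/4)R², so batches have bounded size (`batchSize_le`).
Since A_N is of order N²/(aL), accuracy ε follows once N ≥ 100·M·ℓ with M = max{√(LR²/ε), σ²R²/ε²}
(`le_of_bigA_mul_le`). This condition has N on both sides and is solved by `mul_log_le_of_le`. -/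

namespace ClippedSSTM

/-! ### Smooth convex functions and the deterministic energy estimate. -/

section SmoothConvex

variable {F : Type*} [NormedAddCommGroup F] [InnerProductSpace ℝ F] [CompleteSpace F]
  {f : F → ℝ} {L : ℝ}

lemma hasDerivAt_comp_line (hf : Differentiable ℝ f) (x d : F) (t : ℝ) :
    HasDerivAt (fun t : ℝ => f (x + t • d)) (inner ℝ (gradient f (x + t • d)) d) t := by
  have h1 : HasDerivAt (fun t : ℝ => x + t • d) d t := by
    simpa using ((hasDerivAt_id t).smul_const d).const_add x
  exact (hf (x + t • d)).hasGradientAt.hasFDerivAt.comp_hasDerivAt t h1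

/-- The graph of a differentiable convex function lies above its tangent planes. -/
lemma add_inner_gradient_le (hf : Differentiable ℝ f) (hc : ConvexOn ℝ Set.univ f) (x y : F) :
    f x + inner ℝ (gradient f x) (y - x) ≤ f y := by
  have hconv : ConvexOn ℝ Set.univ (fun t : ℝ => f (x + t • (y - x))) := by
    have := hc.comp_affineMap (AffineMap.lineMap x y : ℝ →ᵃ[ℝ] F)
    simpa [Function.comp_def, AffineMap.lineMap_apply, add_comm] using this
  have hd := hasDerivAt_comp_line hf x (y - x) 0
  have := hconv.le_slope_of_hasDerivAt (Set.mem_univ 0) (Set.mem_univ 1) one_pos hd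
  simp only [slope_def_field, zero_smul, one_smul, add_zero, add_sub_cancel, sub_zero,
    div_one] at this
  linarith

/-- The quadratic upper bound for functions with Lipschitz gradient. -/
lemma le_add_inner_gradient_add (hf : Differentiable ℝ f)
    (hL : ∀ x y, ‖gradient f x - gradient f y‖ ≤ L * ‖x - y‖) (x y : F) :
    f y ≤ f x + inner ℝ (gradient f x) (y - x) + L / 2 * ‖y - x‖ ^ 2 := by
  set d := y - x with hd
  -- f along the segment minus the claimed bound, up to a constant; the Lipschitz gradient makes φ
  -- decreasing, and the claim compares t = 0 with t = 1.
  let φ : ℝ → ℝ := fun t =>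
    f (x + t • d) - t * inner ℝ (gradient f x) d - t ^ 2 * (L / 2 * ‖d‖ ^ 2)
  have hφ : ∀ t, HasDerivAt φ (inner ℝ (gradient f (x + t • d)) d - inner ℝ (gradient f x) d
      - 2 * t * (L / 2 * ‖d‖ ^ 2)) t := by
    intro t
    have h1 := hasDerivAt_comp_line hf x d t
    have h2 := (hasDerivAt_id t).mul_const (inner ℝ (gradient f x) d)
    have h3 := (hasDerivAt_pow 2 t).mul_const (L / 2 * ‖d‖ ^ 2)
    exact ((h1.sub h2).sub h3).congr_deriv (by simp)
  have hanti : AntitoneOn φ (Set.Icc 0 1) := by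
    apply antitoneOn_of_deriv_nonpos (convex_Icc 0 1)
    · exact fun t _ => (hφ t).continuousAt.continuousWithinAt
    · exact fun t _ => (hφ t).differentiableAt.differentiableWithinAt
    · intro t ht
      rw [interior_Icc] at ht
      rw [(hφ t).deriv, ← inner_sub_left]
      have h1 := real_inner_le_norm (gradient f (x + t • d) - gradient f x) d
      have h2 := hL (x + t • d) x
      rw [add_sub_cancel_left, norm_smul, Real.norm_of_nonneg ht.1.le] at h2
      nlinarith [mul_le_mul_of_nonneg_right h2 (norm_nonneg d)]
  have := hanti (Set.left_mem_Icc.2 zero_le_one) (Set.right_mem_Icc.2 zero_le_one) zero_le_one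
  simp only [φ, one_smul, zero_smul, hd, add_sub_cancel, add_zero] at this
  rw [← hd] at this
  linarith

/-- A gradient step of length 1/L lowers f by at least ‖∇f(x)‖²/(2L), yet cannot go below the
minimum. -/
lemma norm_gradient_sq_le (hL0 : 0 < L) (hf : Differentiable ℝ f)
    (hL : ∀ x y, ‖gradient f x - gradient f y‖ ≤ L * ‖x - y‖) {xs : F} (hxs : ∀ x, f xs ≤ f x)
    (x : F) : ‖gradient f x‖ ^ 2 ≤ 2 * L * (f x - f xs) := by
  have h := (hxs _).trans (le_add_inner_gradient_add hf hL x (x - L⁻¹ • gradient f x))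
  rw [sub_sub_cancel_left, inner_neg_right, norm_neg, inner_smul_right, norm_smul,
    real_inner_self_eq_norm_sq, Real.norm_of_nonneg (inv_nonneg.2 hL0.le)] at h
  have h2 : L / 2 * (L⁻¹ * ‖gradient f x‖) ^ 2 = L⁻¹ * ‖gradient f x‖ ^ 2 / 2 := by
    field_simp
  rw [h2] at h
  have h3 : L⁻¹ * ‖gradient f x‖ ^ 2 ≤ 2 * (f x - f xs) := by linarith
  rw [inv_mul_le_iff₀ hL0] at h3
  linarith

/-- Needed for the first iteration, where A₀ = 0 and the energy says nothing about f(y⁰). -/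
lemma norm_gradient_le_of_minimizer
    (hL : ∀ x y, ‖gradient f x - gradient f y‖ ≤ L * ‖x - y‖) {xs : F} (hxs : ∀ x, f xs ≤ f x)
    (x : F) : ‖gradient f x‖ ≤ L * ‖x - xs‖ := by
  have h0 : gradient f xs = 0 := by
    have : fderiv ℝ f xs = 0 := IsLocalMin.fderiv_eq_zero (Filter.Eventually.of_forall hxs)
    simp [gradient, this]
  simpa [h0] using hL x xs

/-- One step of the similar triangles method with an inexact gradient `g`. -/
lemma similar_triangles_step (hf : Differentiable ℝ f) (hc : ConvexOn ℝ Set.univ f)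
    (hL : ∀ x y, ‖gradient f x - gradient f y‖ ≤ L * ‖x - y‖) {A α : ℝ} (hA : 0 ≤ A)
    (hα : 0 < α) (hLα : 2 * L * α ^ 2 ≤ A + α) (u x y z g z' y' : F)
    (hx : x = (A + α)⁻¹ • (A • y + α • z)) (hz' : z' = z - α • g)
    (hy' : y' = (A + α)⁻¹ • (A • y + α • z')) :
    (A + α) * (f y' - f u) + ‖z' - u‖ ^ 2 / 2 ≤ A * (f y - f u) + ‖z - u‖ ^ 2 / 2
      + (α * inner ℝ (g - gradient f x) (u - z) + α ^ 2 * ‖g - gradient f x‖ ^ 2) := by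
  have hAα : 0 < A + α := by linarith
  have hx2 : A • (y - x) = α • (x - z) := by
    have : (A + α) • x = A • y + α • z := by rw [hx, smul_inv_smul₀ hAα.ne']
    rw [add_smul] at this
    rw [smul_sub, smul_sub, sub_eq_sub_iff_add_eq_add, ← this, add_comm]
  have hyx : y' - x = (-(α ^ 2 / (A + α))) • g := by
    rw [hy', hx, hz', ← smul_sub, add_sub_add_left_eq_sub, ← smul_sub, sub_sub_cancel_left,
      smul_neg, smul_neg, smul_smul, smul_smul, neg_smul]
    congr 2; field_simp
  set v := gradient f x with hv
  have h1 := add_inner_gradient_le hf hc x y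
  have h2 := add_inner_gradient_le hf hc x u
  have h3 := le_add_inner_gradient_add hf hL x y'
  rw [← hv] at h1 h2 h3
  have h1' : A * inner ℝ v (y - x) = α * inner ℝ v (x - z) := by
    rw [← inner_smul_right, hx2, inner_smul_right]
  rw [hyx, inner_smul_right, norm_smul, mul_pow, Real.norm_eq_abs, sq_abs] at h3
  have h3' : (A + α) * f y' ≤ (A + α) * f x - α ^ 2 * inner ℝ v g + α ^ 2 * ‖g‖ ^ 2 / 4 := by
    have e : (A + α) * (f x + -(α ^ 2 / (A + α)) * inner ℝ v g
        + L / 2 * ((-(α ^ 2 / (A + α))) ^ 2 * ‖g‖ ^ 2))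
        = (A + α) * f x - α ^ 2 * inner ℝ v g
          + (2 * L * α ^ 2 / (A + α)) * (α ^ 2 * ‖g‖ ^ 2 / 4) := by
      field_simp; ring
    have hle : 2 * L * α ^ 2 / (A + α) ≤ 1 := (div_le_one hAα).2 hLα
    have := mul_le_mul_of_nonneg_left h3 hAα.le
    rw [e] at this
    have := mul_le_mul_of_nonneg_right hle (by positivity : 0 ≤ α ^ 2 * ‖g‖ ^ 2 / 4)
    linarith
  have h4 : ‖z' - u‖ ^ 2 = ‖z - u‖ ^ 2 - 2 * α * inner ℝ g (z - u) + α ^ 2 * ‖g‖ ^ 2 := by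
    rw [hz', sub_right_comm, norm_sub_sq_real, inner_smul_right, norm_smul, mul_pow,
      Real.norm_eq_abs, sq_abs, real_inner_comm]
    ring
  have h5 : ‖g - v‖ ^ 2 = ‖g‖ ^ 2 - 2 * inner ℝ v g + ‖v‖ ^ 2 := by
    rw [norm_sub_sq_real, real_inner_comm]
  -- This square is the slack of the whole estimate: α²‖g - v‖² - (3/4)α²‖g‖² + α²⟨v, g⟩ = α²‖g -
  -- 2v‖²/4.
  have h6 : (0 : ℝ) ≤ ‖g - (2 : ℝ) • v‖ ^ 2 := sq_nonneg _
  rw [norm_sub_sq_real, inner_smul_right, norm_smul, mul_pow, real_inner_comm] at h6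
  norm_num at h6
  have h7 : inner ℝ (g - v) (u - z) = - inner ℝ g (z - u) + inner ℝ v (z - u) := by
    rw [inner_sub_left, ← neg_sub z u, inner_neg_right, inner_neg_right]; ring
  have h8 : inner ℝ v (u - x) = inner ℝ v (z - x) - inner ℝ v (z - u) := by
    rw [← inner_sub_right, sub_sub_sub_cancel_left]
  have h9 : inner ℝ v (x - z) = - inner ℝ v (z - x) := by rw [← inner_neg_right, neg_sub]
  rw [h4, h7, h5]
  rw [h8] at h2
  rw [h9] at h1'
  nlinarith [mul_le_mul_of_nonneg_left h1 hA, mul_le_mul_of_nonneg_left h2 hα.le,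
    mul_nonneg (sq_nonneg α) h6]

end SmoothConvex
-- Bias and contraction properties of clipping.
section Clip

variable {n : ℕ} {lam : ℝ} {g v : E n}

lemma clip_of_norm_le (h : ‖g‖ ≤ lam) : clip g lam = g := by
  rcases eq_or_ne g 0 with rfl | hg
  · simp [clip]
  · rw [clip, min_eq_left ((one_le_div (norm_pos_iff.2 hg)).2 h), one_smul]

lemma clip_of_lt_norm (h : lam < ‖g‖) (h0 : 0 ≤ lam) : clip g lam = (lam / ‖g‖) • g := by
  rw [clip, min_eq_right ((div_le_one (h0.trans_lt h)).2 h.le)]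

lemma norm_clip_le (h0 : 0 ≤ lam) (g : E n) : ‖clip g lam‖ ≤ lam := by
  rcases le_or_gt ‖g‖ lam with h | h
  · rwa [clip_of_norm_le h]
  · have := h0.trans_lt h
    rw [clip_of_lt_norm h h0, norm_smul, Real.norm_of_nonneg (by positivity),
      div_mul_cancel₀ _ this.ne']

/-- Clipping is the projection onto a ball, hence does not increase the distance to its points. -/
lemma norm_clip_sub_le (hv : ‖v‖ ≤ lam) (g : E n) : ‖clip g lam - v‖ ≤ ‖g - v‖ := by
  have h0 : 0 ≤ lam := (norm_nonneg v).trans hv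
  rcases le_or_gt ‖g‖ lam with h | h
  · rw [clip_of_norm_le h]
  · have hg := h0.trans_lt h
    rw [clip_of_lt_norm h h0]
    refine le_of_sq_le_sq ?_ (norm_nonneg _)
    set κ := lam / ‖g‖ with hκ
    have hκg : κ * ‖g‖ = lam := div_mul_cancel₀ _ hg.ne'
    have hκ1 : κ ≤ 1 := (div_le_one hg).2 h.le
    have hκ0 : 0 ≤ κ := by positivity
    rw [norm_sub_sq_real, norm_sub_sq_real, inner_smul_left, norm_smul,
      Real.norm_of_nonneg hκ0, hκg]
    have h1 : inner ℝ g v ≤ ‖g‖ * lam :=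
      (real_inner_le_norm g v).trans (mul_le_mul_of_nonneg_left hv hg.le)
    have h2 := mul_le_mul_of_nonneg_left h1 (sub_nonneg.2 hκ1)
    simp only [conj_trivial]
    nlinarith [sq_nonneg (‖g‖ - lam)]

/-- When clipping acts, it removes length ‖g‖ - lam ≤ d - lam/2 with d = ‖g - v‖, and d - lam/2 ≤
d²/(2·lam) is (d - lam)² ≥ 0. The bias is thus of second order in the error. -/
lemma norm_sub_clip_le (h0 : 0 < lam) (hv : ‖v‖ ≤ lam / 2) (g : E n) :
    ‖clip g lam - g‖ ≤ ‖g - v‖ ^ 2 / (2 * lam) := by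
  rcases le_or_gt ‖g‖ lam with h | h
  · rw [clip_of_norm_le h, sub_self, norm_zero]; positivity
  · have hg := h0.trans h
    have hκ1 : lam / ‖g‖ ≤ 1 := (div_le_one hg).2 h.le
    have e : clip g lam - g = (lam / ‖g‖ - 1) • g := by
      rw [clip_of_lt_norm h h0.le, sub_smul, one_smul]
    rw [e, norm_smul, Real.norm_of_nonpos (by linarith), neg_sub, sub_mul, one_mul,
      div_mul_cancel₀ _ hg.ne', le_div_iff₀ (by positivity)]
    have h1 : ‖g‖ ≤ ‖g - v‖ + lam / 2 := by
      linarith [norm_le_norm_sub_add g v]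
    nlinarith [sq_nonneg (‖g - v‖ - lam)]

end Clip

/-! ### Closed forms and inequalities for the stepsizes. -/

section Stepsizes

variable {a L : ℝ}

lemma bigA_eq (a L : ℝ) (k : ℕ) : bigA a L k = k * (k + 3) / (4 * a * L) := by
  induction k with
  | zero => simp [bigA]
  | succ k ih =>
    rw [bigA, ih, alpha]
    push_cast
    rcases eq_or_ne a 0 with rfl | ha
    · simp
    rcases eq_or_ne L 0 with rfl | hL
    · simp
    field_simp
    ring

lemma alpha_succ_pos (ha : 0 < a) (hL : 0 < L) (k : ℕ) : 0 < alpha a L (k + 1) := by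
  rw [alpha]; positivity

lemma bigA_nonneg (ha : 0 < a) (hL : 0 < L) (k : ℕ) : 0 ≤ bigA a L k := by
  rw [bigA_eq]; positivity

lemma bigA_succ_pos (ha : 0 < a) (hL : 0 < L) (k : ℕ) : 0 < bigA a L (k + 1) :=
  add_pos_of_nonneg_of_pos (bigA_nonneg ha hL k) (alpha_succ_pos ha hL k)

/-- At a = 2 this reduces to (k+2)² ≤ (k+1)(k+4), an equality for k = 0. -/
lemma two_mul_alpha_sq_le (ha : 2 ≤ a) (hL : 0 < L) (k : ℕ) :
    2 * L * alpha a L (k + 1) ^ 2 ≤ bigA a L k + alpha a L (k + 1) := by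
  have : bigA a L k + alpha a L (k + 1) = bigA a L (k + 1) := rfl
  rw [this, bigA_eq, alpha]
  have ha0 : 0 < a := by linarith
  have e : 2 * L * (((k : ℝ) + 2) / (2 * a * L)) ^ 2 = (2 * (k + 2) ^ 2 / a) / (4 * a * L) * 1 := by
    field_simp; ring
  rw [e, mul_one]
  gcongr
  rw [div_le_iff₀ ha0]
  push_cast
  have hk : (0 : ℝ) ≤ k := k.cast_nonneg
  nlinarith [mul_nonneg hk hk,
    mul_nonneg (sub_nonneg.2 ha) (by positivity : (0 : ℝ) ≤ (k + 1) * (k + 4))]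

/-- Amounts to (k+2)² ≤ (9/4)k(k+3), sharp at k = 1. -/
lemma alpha_sq_le_bigA (ha : 0 < a) (hL : 0 < L) {k : ℕ} (hk : 1 ≤ k) :
    L * alpha a L (k + 1) ^ 2 ≤ 9 / (4 * a) * bigA a L k := by
  rw [bigA_eq, alpha]
  have e : L * (((k : ℝ) + 2) / (2 * a * L)) ^ 2 = (k + 2) ^ 2 / (4 * a ^ 2 * L) := by
    field_simp; ring
  have e2 : 9 / (4 * a) * ((k : ℝ) * (k + 3) / (4 * a * L))
      = (9 / 4 * (k * (k + 3))) / (4 * a ^ 2 * L) := by field_simp; try ring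
  rw [e, e2]
  gcongr
  have hk : (1 : ℝ) ≤ k := by exact_mod_cast hk
  nlinarith

end Stepsizes

/-! ### Stopped noise, energy of the iterates, and gradients inside the region. -/

section Trajectory

variable {n : ℕ} {Ξ : Type u} {f : E n → ℝ} {G : E n → Ξ → E n} {a L B b ρ : ℝ} {m : ℕ → ℕ}
  {x0 xs : E n}

/-- The extrapolation point `x^{k+1}` determined by the pair `(yᵏ, zᵏ)`. -/
noncomputable def extrapolation (a L : ℝ) (k : ℕ) (p : E n × E n) : E n :=
  (bigA a L (k + 1))⁻¹ • (bigA a L k • p.1 + alpha a L (k + 1) • p.2)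

/-- The error term contributed by iteration `k` to the energy estimate. -/
noncomputable def noise (f : E n → ℝ) (G : E n → Ξ → E n) (a L B : ℝ) (m : ℕ → ℕ) (xs : E n)
    (k : ℕ) (p : E n × E n) (s : ℕ → Ξ) : ℝ :=
  let x := extrapolation a L k p
  let θ := clip (miniBatch G x (m k) s) (B / alpha a L (k + 1)) - gradient f x
  alpha a L (k + 1) * inner ℝ θ (xs - p.2) + alpha a L (k + 1) ^ 2 * ‖θ‖ ^ 2

/-- The region in which clipping does not affect the exact gradient. -/
def InRegion (f : E n → ℝ) (a L ρ : ℝ) (xs : E n) (k : ℕ) (p : E n × E n) : Prop :=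
  ‖p.2 - xs‖ ≤ ρ ∧ ‖p.1 - xs‖ ≤ ρ ∧ bigA a L k * (f p.1 - f xs) ≤ ρ ^ 2 / 2

open Classical in
/-- The noise of iteration `k`, switched off once the accumulated noise `q.2` exceeds `b` or the
iterates `q.1` are outside the region. -/
noncomputable def gatedNoise (f : E n → ℝ) (G : E n → Ξ → E n) (a L B : ℝ) (m : ℕ → ℕ)
    (xs : E n) (ρ b : ℝ) (k : ℕ) (q : (E n × E n) × ℝ) (s : ℕ → Ξ) : ℝ :=
  if q.2 ≤ b ∧ InRegion f a L ρ xs k q.1 then noise f G a L B m xs k q.1 s else 0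

/-- The accumulated noise, frozen once it exceeds `b` or the iterates leave the region. -/
noncomputable def stoppedNoise (f : E n → ℝ) (G : E n → Ξ → E n) (a L B : ℝ) (m : ℕ → ℕ)
    (x0 xs : E n) (ρ b : ℝ) (s : ℕ → ℕ → Ξ) : ℕ → ℝ
  | 0 => 0
  | k + 1 => stoppedNoise f G a L B m x0 xs ρ b s k +
      gatedNoise f G a L B m xs ρ b k
        (iterates G a L B m x0 s k, stoppedNoise f G a L B m x0 xs ρ b s k) (s k)

lemma norm_extrapolation_sub_le (ha : 0 < a) (hL : 0 < L) (k : ℕ) {p : E n × E n} {u : E n}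
    (h1 : ‖p.1 - u‖ ≤ ρ) (h2 : ‖p.2 - u‖ ≤ ρ) : ‖extrapolation a L k p - u‖ ≤ ρ := by
  have hA := bigA_nonneg ha hL k
  have hα := alpha_succ_pos ha hL k
  have hA' := bigA_succ_pos ha hL k
  have e : extrapolation a L k p - u = (bigA a L (k + 1))⁻¹ •
      (bigA a L k • (p.1 - u) + alpha a L (k + 1) • (p.2 - u)) := by
    have : u = (bigA a L (k + 1))⁻¹ • (bigA a L (k + 1)) • u := (inv_smul_smul₀ hA'.ne' u).symm
    rw [extrapolation]
    conv_lhs => rw [this]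
    rw [← smul_sub]
    congr 1
    rw [bigA, add_smul, smul_sub, smul_sub]
    abel
  rw [e, norm_smul, norm_inv, Real.norm_of_nonneg hA'.le, inv_mul_le_iff₀ hA']
  calc _ ≤ bigA a L k * ‖p.1 - u‖ + alpha a L (k + 1) * ‖p.2 - u‖ := by
        refine (norm_add_le _ _).trans ?_
        rw [norm_smul, norm_smul, Real.norm_of_nonneg hA, Real.norm_of_nonneg hα.le]
    _ ≤ bigA a L k * ρ + alpha a L (k + 1) * ρ := by gcongr
    _ = _ := by rw [bigA]; ring

lemma iterates_succ (s : ℕ → ℕ → Ξ) (k : ℕ) :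
    iterates G a L B m x0 s (k + 1) =
      let p := iterates G a L B m x0 s k
      let z' := p.2 - alpha a L (k + 1) • clip (miniBatch G (extrapolation a L k p) (m k) (s k))
        (B / alpha a L (k + 1))
      (extrapolation a L k (p.1, z'), z') := rfl

/-- While the noise has not been stopped, it controls the energy of the iterates. -/
lemma energy_le (hf : IsSmooth L f) (hc : ConvexOn ℝ Set.univ f) (hxs : ∀ x, f xs ≤ f x)
    (ha : 2 ≤ a) (hL : 0 < L) (hb : 0 ≤ b) (hρ0 : 0 ≤ ρ)
    (hρ : ‖x0 - xs‖ ^ 2 + 2 * b ≤ ρ ^ 2) (s : ℕ → ℕ → Ξ) (k : ℕ)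
    (h : stoppedNoise f G a L B m x0 xs ρ b s k ≤ b) :
    bigA a L k * (f (iterates G a L B m x0 s k).1 - f xs)
        + ‖(iterates G a L B m x0 s k).2 - xs‖ ^ 2 / 2
      ≤ ‖x0 - xs‖ ^ 2 / 2 + stoppedNoise f G a L B m x0 xs ρ b s k ∧
    InRegion f a L ρ xs k (iterates G a L B m x0 s k) := by
  have ha0 : 0 < a := by linarith
  induction k with
  | zero =>
    have : ‖x0 - xs‖ ≤ ρ := le_of_sq_le_sq (by linarith) hρ0
    refine ⟨by simp [bigA, iterates, stoppedNoise], this, this, ?_⟩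
    simp only [bigA]; nlinarith
  | succ k ih =>
    have hk : stoppedNoise f G a L B m x0 xs ρ b s k ≤ b := by
      -- Above b the noise is frozen, so a bound by b at time k+1 forces one at time k.
      by_contra hk
      rw [stoppedNoise, gatedNoise, if_neg (fun h => hk h.1), add_zero] at h
      exact hk h
    obtain ⟨ih1, ih2⟩ := ih hk
    have hS : stoppedNoise f G a L B m x0 xs ρ b s (k + 1)
        = stoppedNoise f G a L B m x0 xs ρ b s k
          + noise f G a L B m xs k (iterates G a L B m x0 s k) (s k) := by
      rw [stoppedNoise, gatedNoise, if_pos ⟨hk, ih2⟩]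
    rw [hS] at h ⊢
    rw [iterates_succ]
    set p := iterates G a L B m x0 s k
    set g := clip (miniBatch G (extrapolation a L k p) (m k) (s k)) (B / alpha a L (k + 1)) with hg
    set z' := p.2 - alpha a L (k + 1) • g with hz'
    have step := similar_triangles_step hf.1 hc hf.2 (bigA_nonneg ha0 hL k)
      (alpha_succ_pos ha0 hL k) (two_mul_alpha_sq_le ha hL k) xs (extrapolation a L k p) p.1 p.2 g
      z' (extrapolation a L k (p.1, z')) rfl hz' rfl
    change bigA a L (k + 1) * _ + _ ≤ _ + noise f G a L B m xs k p (s k) at step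
    have h1 : bigA a L (k + 1) * (f (extrapolation a L k (p.1, z')) - f xs)
        + ‖z' - xs‖ ^ 2 / 2 ≤ ‖x0 - xs‖ ^ 2 / 2
          + (stoppedNoise f G a L B m x0 xs ρ b s k + noise f G a L B m xs k p (s k)) := by
      linarith
    have h2 : 0 ≤ bigA a L (k + 1) * (f (extrapolation a L k (p.1, z')) - f xs) :=
      mul_nonneg (bigA_nonneg ha0 hL _) (sub_nonneg.2 (hxs _))
    have h3 : ‖z' - xs‖ ≤ ρ := le_of_sq_le_sq (by linarith) hρ0
    refine ⟨h1, h3, norm_extrapolation_sub_le ha0 hL k ih2.2.1 h3, ?_⟩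
    dsimp only
    linarith [sq_nonneg ‖z' - xs‖]

/-- In the region, gradients at extrapolation points are at most half of the clipping level. -/
lemma norm_gradient_extrapolation_le (hf : IsSmooth L f) (hxs : ∀ x, f xs ≤ f x) (hL : 0 < L)
    {l : ℝ} (hl : 2 ≤ l) (hρ0 : 0 ≤ ρ)
    (ha : 36 * (2 * l + Real.sqrt (4 * l ^ 2 + 2 * l)) ^ 2 ≤ a) {k : ℕ} {p : E n × E n}
    (hp : InRegion f a L ρ xs k p) :
    ‖gradient f (extrapolation a L k p)‖ ≤ ρ / (8 * l) / alpha a L (k + 1) / 2 := by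
  set w := Real.sqrt (4 * l ^ 2 + 2 * l) with hw
  set u := 2 * l + w with hu
  have hw2 : w ^ 2 = 4 * l ^ 2 + 2 * l := Real.sq_sqrt (by positivity)
  have hw0 : 2 * l ≤ w := Real.le_sqrt_of_sq_le (by nlinarith)
  -- u is the positive root of u² = 4lu + 2l; this choice makes the last two lines of the final
  -- computation equalities.
  have hu2 : u ^ 2 = 2 * l * (2 * u + 1) := by rw [hu]; nlinarith
  have hu0 : 4 * l ≤ u := by linarith
  have hupos : 0 < u := by linarith
  have ha0 : 0 < a := lt_of_lt_of_le (by positivity) ha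
  have hα := alpha_succ_pos ha0 hL k
  rw [div_div, div_div, le_div_iff₀ (by positivity)]
  obtain ⟨h1, h2, h3⟩ := hp
  rcases Nat.eq_zero_or_pos k with rfl | hk
  · have hx := norm_extrapolation_sub_le ha0 hL 0 h2 h1
    have hg := norm_gradient_le_of_minimizer hf.2 hxs (extrapolation a L 0 p)
    have hg' : ‖gradient f (extrapolation a L 0 p)‖ ≤ L * ρ := hg.trans (by gcongr)
    have hal : alpha a L (0 + 1) = 1 / (a * L) := by
      simp only [alpha]; push_cast; field_simp; ring
    have h16 : 16 * l ≤ a := by nlinarith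
    calc _ ≤ L * ρ * (8 * l * (alpha a L (0 + 1) * 2)) :=
          mul_le_mul_of_nonneg_right hg' (by positivity)
      _ = ρ * (16 * l) / a := by rw [hal]; field_simp; ring
      _ ≤ ρ := by rw [div_le_iff₀ ha0]; gcongr
  · have hAk : 0 < bigA a L k := by
      obtain ⟨j, rfl⟩ := Nat.exists_eq_succ_of_ne_zero hk.ne'
      exact bigA_succ_pos ha0 hL j
    set A := bigA a L k with hA
    set α := alpha a L (k + 1) with hαdef
    set x := extrapolation a L k p with hx
    set q := Real.sqrt (L / A) with hq
    have hq0 : 0 ≤ q := Real.sqrt_nonneg _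
    have hq2 : q ^ 2 = L / A := Real.sq_sqrt (by positivity)
    -- α²L/A ≤ 9/(4a) and a ≥ 36u² give exactly 1/(16u²).
    have hαq : α * q ≤ 1 / (4 * u) := by
      refine le_of_sq_le_sq ?_ (by positivity)
      rw [mul_pow, hq2, div_pow, one_pow, mul_div_assoc', div_le_div_iff₀ hAk (by positivity)]
      have := alpha_sq_le_bigA ha0 hL hk
      rw [← hA, ← hαdef, div_mul_eq_mul_div, le_div_iff₀ (by positivity)] at this
      have h36 : 36 * u ^ 2 * (L * α ^ 2) ≤ a * (L * α ^ 2) := by gcongr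
      nlinarith
    have hxy : ‖x - p.1‖ ≤ α / A * (2 * ρ) := by
      have e : x - p.1 = (α / (A + α)) • (p.2 - p.1) := by
        have : (A + α) ≠ 0 := by positivity
        have e1 : x = (A + α)⁻¹ • (A • p.1 + α • p.2) := rfl
        have e2 : p.1 = (A + α)⁻¹ • (A + α) • p.1 := (inv_smul_smul₀ this _).symm
        rw [e1]
        conv_lhs => rw [e2]
        rw [div_eq_inv_mul, mul_smul, ← smul_sub]
        conv_rhs => rw [e2]
        simp only [inv_smul_smul₀ this]
        congr 1
        rw [add_smul, smul_sub]
        abel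
      rw [e, norm_smul, Real.norm_of_nonneg (by positivity)]
      have h4 : ‖p.2 - p.1‖ ≤ 2 * ρ := by
        rw [← sub_sub_sub_cancel_right p.2 p.1 xs]
        exact (norm_sub_le _ _).trans (by linarith)
      gcongr
      linarith
    have hgx : ‖gradient f x - gradient f p.1‖ ≤ 2 * ρ * (α * q ^ 2) := by
      refine (hf.2 x p.1).trans ?_
      rw [hq2]
      calc L * ‖x - p.1‖ ≤ L * (α / A * (2 * ρ)) := by gcongr
        _ = _ := by ring
    have hgy : ‖gradient f p.1‖ ≤ ρ * q := by
      refine le_of_sq_le_sq ?_ (by positivity)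
      refine (norm_gradient_sq_le hL hf.1 hf.2 hxs p.1).trans ?_
      rw [mul_pow, hq2, mul_div_assoc', le_div_iff₀ hAk]
      nlinarith
    have hg : ‖gradient f x‖ ≤ 2 * ρ * (α * q ^ 2) + ρ * q :=
      (norm_le_norm_sub_add _ (gradient f p.1)).trans (add_le_add hgx hgy)
    have hαq0 : 0 ≤ α * q := by positivity
    calc ‖gradient f x‖ * (8 * l * (α * 2))
        ≤ (2 * ρ * (α * q ^ 2) + ρ * q) * (8 * l * (α * 2)) := by gcongr
      _ = ρ * (16 * l * (2 * (α * q) ^ 2 + α * q)) := by ring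
      _ ≤ ρ * (16 * l * (2 * (1 / (4 * u)) ^ 2 + 1 / (4 * u))) := by gcongr
      _ = ρ * ((2 * l * (2 * u + 1)) / u ^ 2) := by field_simp; ring
      _ = ρ := by rw [← hu2, div_self (by positivity), mul_one]

end Trajectory
-- Moments of mini-batches and of the clipped error.
section Moments

variable {Ω : Type*} [MeasurableSpace Ω] {μ : Measure Ω} {n : ℕ}

lemma memLp_coord {Y : Ω → E n} (hY : MemLp Y 2 μ) (j : Fin n) :
    MemLp (fun ω => Y ω j) 2 μ :=
  (EuclideanSpace.proj (𝕜 := ℝ) j).comp_memLp' hY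

lemma integral_norm_sq_eq_sum {Y : Ω → E n} (hY : MemLp Y 2 μ) :
    ∫ ω, ‖Y ω‖ ^ 2 ∂μ = ∑ j, ∫ ω, Y ω j ^ 2 ∂μ := by
  rw [← integral_finsetSum _ fun j _ => (memLp_coord hY j).integrable_sq]
  simp_rw [EuclideanSpace.real_norm_sq_eq]

/-- Second moments of centred pairwise independent random vectors add up. -/
lemma integral_norm_sum_sq [IsProbabilityMeasure μ] {ι : Type*} {Y : ι → Ω → E n} {s : Finset ι}
    (hY : ∀ i ∈ s, MemLp (Y i) 2 μ) (h0 : ∀ i ∈ s, ∫ ω, Y i ω ∂μ = 0)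
    (hind : Set.Pairwise ↑s fun i j => IndepFun (Y i) (Y j) μ) :
    ∫ ω, ‖∑ i ∈ s, Y i ω‖ ^ 2 ∂μ = ∑ i ∈ s, ∫ ω, ‖Y i ω‖ ^ 2 ∂μ := by
  have hcoord0 : ∀ i ∈ s, ∀ j, ∫ ω, Y i ω j ∂μ = 0 := by
    intro i hi j
    have := (EuclideanSpace.proj (𝕜 := ℝ) (j : Fin n)).integral_comp_comm
      ((hY i hi).integrable one_le_two)
    rw [h0 i hi] at this
    simpa using this
  -- Coordinate by coordinate, the claim is additivity of variance.
  rw [integral_norm_sq_eq_sum (memLp_finsetSum s hY),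
    Finset.sum_congr rfl fun i hi => integral_norm_sq_eq_sum (hY i hi), Finset.sum_comm]
  refine Finset.sum_congr rfl fun j _ => ?_
  have hv := IndepFun.variance_sum (μ := μ) (X := fun i ω => Y i ω j) (s := s)
    (fun i hi => memLp_coord (hY i hi) j)
    (fun i hi k hk hik => (hind hi hk hik).comp
      (φ := fun y : E n => y j) (ψ := fun y : E n => y j) (by fun_prop) (by fun_prop))
  have hint : ∀ i ∈ s, Integrable (fun ω => Y i ω j) μ := fun i hi =>
    (memLp_coord (hY i hi) j).integrable one_le_two
  rw [variance_of_integral_eq_zero] at hv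
  · simp only [Finset.sum_apply] at hv
    simp only [WithLp.ofLp_sum, Finset.sum_apply]
    rw [hv]
    refine Finset.sum_congr rfl fun i hi => ?_
    rw [variance_of_integral_eq_zero (hint i hi).aemeasurable (hcoord0 i hi j)]
  · exact (memLp_finsetSum' s fun i hi => memLp_coord (hY i hi) j).aemeasurable
  · simp only [Finset.sum_apply]
    rw [integral_finsetSum s hint]
    exact Finset.sum_eq_zero fun i hi => hcoord0 i hi j

variable {Ξ : Type u} [MeasurableSpace Ξ] {D : Measure Ξ} {f : E n → ℝ} {G : E n → Ξ → E n}
  {σ : ℝ}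

/-- Mean and variance of the mini-batched stochastic gradient. -/
lemma miniBatch_moments [IsProbabilityMeasure μ] (hG : IsStochasticGradient D f G σ)
    {ξ : ℕ → Ω → Ξ} (hξ : ∀ i, Measurable (ξ i)) (hD : ∀ i, μ.map (ξ i) = D)
    (hind : Pairwise fun i j => IndepFun (ξ i) (ξ j) μ) (x : E n) {m : ℕ} (hm : 0 < m) :
    Integrable (fun ω => miniBatch G x m (fun i => ξ i ω)) μ ∧
    ∫ ω, miniBatch G x m (fun i => ξ i ω) ∂μ = gradient f x ∧
    Integrable (fun ω => ‖miniBatch G x m (fun i => ξ i ω) - gradient f x‖ ^ 2) μ ∧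
    ∫ ω, ‖miniBatch G x m (fun i => ξ i ω) - gradient f x‖ ^ 2 ∂μ ≤ σ ^ 2 / m := by
  have hGx : Measurable (G x) := hG.measurable.comp measurable_prodMk_left
  have hm0 : (m : ℝ) ≠ 0 := by positivity
  set v := gradient f x with hv
  have hint : ∀ i, Integrable (fun ω => G x (ξ i ω)) μ := fun i => by
    have := hG.integrable x
    rw [← hD i] at this
    exact this.comp_measurable (hξ i)
  have hmean : ∀ i, ∫ ω, G x (ξ i ω) ∂μ = v := fun i => by
    rw [← integral_map (hξ i).aemeasurable hGx.aestronglyMeasurable, hD i, hG.unbiased]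
  let Y : ℕ → Ω → E n := fun i ω => G x (ξ i ω) - v
  have hYL : ∀ i, MemLp (Y i) 2 μ := fun i => by
    refine (memLp_two_iff_integrable_sq_norm
      ((hint i).sub (integrable_const v)).aestronglyMeasurable).2 ?_
    have := hG.sq_integrable x
    rw [← hD i] at this
    exact this.comp_measurable (hξ i)
  have hY0 : ∀ i, ∫ ω, Y i ω ∂μ = 0 := fun i => by
    simp only [Y]
    rw [integral_sub (hint i) (integrable_const v), hmean i]
    simp
  have hYvar : ∀ i, ∫ ω, ‖Y i ω‖ ^ 2 ∂μ ≤ σ ^ 2 := fun i => by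
    have h1 : Measurable fun s => ‖G x s - v‖ ^ 2 := ((hGx.sub_const v).norm).pow_const 2
    have := integral_map (hξ i).aemeasurable (μ := μ) h1.aestronglyMeasurable
    rw [hD i] at this
    simp only [Y]
    rw [← this]
    exact hG.variance_le x
  have hYind : Set.Pairwise ↑(Finset.range m) fun i j => IndepFun (Y i) (Y j) μ :=
    fun i _ j _ hij => (hind hij).comp (φ := fun s => G x s - v) (ψ := fun s => G x s - v)
      (hGx.sub_const v) (hGx.sub_const v)
  have hsum := integral_norm_sum_sq (fun i _ => hYL i) (fun i _ => hY0 i) hYind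
  have hdiff : ∀ ω, miniBatch G x m (fun i => ξ i ω) - v
      = (m : ℝ)⁻¹ • ∑ i ∈ Finset.range m, Y i ω := fun ω => by
    simp only [miniBatch, Y, Finset.sum_sub_distrib, smul_sub, Finset.sum_const,
      Finset.card_range]
    rw [← Nat.cast_smul_eq_nsmul ℝ m v, inv_smul_smul₀ hm0]
  have hbound := Finset.sum_le_sum fun i (_ : i ∈ Finset.range m) => hYvar i
  rw [Finset.sum_const, Finset.card_range, nsmul_eq_mul, ← hsum] at hbound
  have hLsum : MemLp (fun ω => (m : ℝ)⁻¹ • ∑ i ∈ Finset.range m, Y i ω) 2 μ :=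
    (memLp_finsetSum (Finset.range m) fun i _ => hYL i).const_smul (m : ℝ)⁻¹
  refine ⟨(integrable_finsetSum _ fun i _ => hint i).smul (m : ℝ)⁻¹, ?_, ?_, ?_⟩
  · simp only [miniBatch]
    rw [integral_smul, integral_finsetSum _ fun i _ => hint i,
      Finset.sum_congr rfl fun i _ => hmean i,
      Finset.sum_const, Finset.card_range, ← Nat.cast_smul_eq_nsmul ℝ, inv_smul_smul₀ hm0]
  · simp only [hdiff]
    exact hLsum.integrable_norm_pow two_ne_zero
  · simp only [hdiff, norm_smul, mul_pow]
    rw [integral_const_mul, norm_inv, Real.norm_natCast]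
    calc _ ≤ ((m : ℝ)⁻¹) ^ 2 * (m * σ ^ 2) := by gcongr
      _ = σ ^ 2 / m := by field_simp

/-- Pointwise bound for the exponential of the error caused by one clipped gradient. -/
lemma exp_clip_error_le {g v w : E n} {α ρ l : ℝ} (hα : 0 < α) (hρ : 0 < ρ) (hl : 2 ≤ l)
    (hv : ‖v‖ ≤ ρ / (8 * l) / α / 2) (hw : ‖w‖ ≤ ρ) :
    Real.exp (4 * l / ρ ^ 2 * (α * inner ℝ (clip g (ρ / (8 * l) / α) - v) w
        + α ^ 2 * ‖clip g (ρ / (8 * l) / α) - v‖ ^ 2))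
      ≤ 1 + 4 * l / ρ ^ 2 * α * inner ℝ (g - v) w
        + 38 * l ^ 2 / ρ ^ 2 * α ^ 2 * ‖g - v‖ ^ 2 := by
  have hl0 : 0 < l := by linarith
  set lam := ρ / (8 * l) / α with hlam
  have hlam0 : 0 < lam := by positivity
  set θ := clip g lam - v with hθ
  have h1 : ‖θ‖ ≤ ‖g - v‖ := norm_clip_sub_le (by linarith) _
  have h2 : ‖θ‖ ≤ 3 * lam / 2 :=
    (norm_sub_le _ _).trans (by linarith [norm_clip_le hlam0.le g])
  -- Split θ into the unclipped error, which will have mean zero, plus the clipping bias, which is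
  -- quadratic in ‖g - v‖.
  have h4 : inner ℝ θ w ≤ inner ℝ (g - v) w + ‖g - v‖ ^ 2 / (2 * lam) * ρ := by
    have e : θ = (g - v) + (clip g lam - g) := by rw [hθ]; abel
    rw [e, inner_add_left]
    gcongr
    exact (real_inner_le_norm _ _).trans (by gcongr; exact norm_sub_clip_le hlam0 hv g)
  have h5 : |inner ℝ θ w| ≤ ‖θ‖ * ρ := (abs_real_inner_le_norm _ _).trans (by gcongr)
  set d := ‖g - v‖
  set t := ‖θ‖ with ht
  have ht0 : 0 ≤ t := norm_nonneg _
  have hp : α * t ≤ 3 * ρ / (16 * l) := by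
    calc α * t ≤ α * (3 * lam / 2) := by gcongr
      _ = _ := by rw [hlam]; field_simp; ring
  have hp2 : α * t ≤ 3 * ρ / 32 := hp.trans (by gcongr; linarith)
  -- Uses α·lam = ρ/(8l): the bias acquires the same factor α² as the variance term.
  have e0 : α * (d ^ 2 / (2 * lam) * ρ) = α ^ 2 * d ^ 2 * (4 * l) := by
    rw [hlam]; field_simp; ring
  generalize inner ℝ θ w = I at *
  generalize inner ℝ (g - v) w = J at *
  clear_value d t lam
  set U := α * I + α ^ 2 * t ^ 2 with hU
  have hU1 : |U| ≤ α * t * (35 / 32 * ρ) := by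
    calc |U| ≤ α * |I| + α ^ 2 * t ^ 2 := by
          refine (abs_add_le _ _).trans ?_
          rw [abs_mul, abs_of_pos hα, abs_of_nonneg (by positivity : 0 ≤ α ^ 2 * t ^ 2)]
      _ ≤ α * (t * ρ) + (α * t) * (α * t) := by
          rw [← sq, mul_pow]; gcongr
      _ ≤ α * (t * ρ) + (α * t) * (3 * ρ / 32) := by gcongr
      _ = _ := by ring
  have hU2 : U ^ 2 ≤ α ^ 2 * d ^ 2 * (6 / 5 * ρ ^ 2) := by
    rw [← sq_abs]
    calc |U| ^ 2 ≤ (α * d * (35 / 32 * ρ)) ^ 2 := by gcongr; exact hU1.trans (by gcongr)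
      _ = α ^ 2 * d ^ 2 * ((35 / 32) ^ 2 * ρ ^ 2) := by ring
      _ ≤ _ := by gcongr; norm_num
  have hUle : U ≤ α * J + α ^ 2 * d ^ 2 * (4 * l + 1) := by
    have h6 := mul_le_mul_of_nonneg_left h4 hα.le
    have h7 : α ^ 2 * t ^ 2 ≤ α ^ 2 * d ^ 2 := by gcongr
    rw [mul_add, e0] at h6
    rw [hU]
    linarith
  clear_value U
  have hs0 : 0 < 4 * l / ρ ^ 2 := by positivity
  -- Clipping is what bounds the exponent by 1, which permits exp x ≤ 1 + x + x².
  have hsU : |4 * l / ρ ^ 2 * U| ≤ 1 := by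
    rw [abs_mul, abs_of_pos hs0]
    calc _ ≤ 4 * l / ρ ^ 2 * (3 * ρ / (16 * l) * (35 / 32 * ρ)) := by
          gcongr; exact hU1.trans (by gcongr)
      _ = 105 / 128 := by field_simp; norm_num
      _ ≤ 1 := by norm_num
  have hexp := (abs_le.1 (Real.abs_exp_sub_one_sub_id_le hsU)).2
  calc _ ≤ 1 + 4 * l / ρ ^ 2 * U + (4 * l / ρ ^ 2) ^ 2 * U ^ 2 := by
        rw [← mul_pow]; linarith only [hexp]
    _ ≤ 1 + 4 * l / ρ ^ 2 * (α * J + α ^ 2 * d ^ 2 * (4 * l + 1))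
        + (4 * l / ρ ^ 2) ^ 2 * (α ^ 2 * d ^ 2 * (6 / 5 * ρ ^ 2)) := by gcongr
    _ = 1 + 4 * l / ρ ^ 2 * α * J
        + (96 / 5 * l ^ 2 + 16 * l ^ 2 + 4 * l) / ρ ^ 2 * α ^ 2 * d ^ 2 := by
        field_simp; ring
    _ ≤ _ := by gcongr; nlinarith only [hl]

/-- Exponential moment of the error caused by one clipped stochastic gradient. -/
lemma lintegral_exp_clip_error_le [IsProbabilityMeasure μ] {X : Ω → E n} {v w : E n}
    {τ α ρ l N : ℝ} (hX : Integrable X μ) (hXv : ∫ ω, X ω ∂μ = v)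
    (hX2 : Integrable (fun ω => ‖X ω - v‖ ^ 2) μ) (hτ : ∫ ω, ‖X ω - v‖ ^ 2 ∂μ ≤ τ)
    (hα : 0 < α) (hρ : 0 < ρ) (hl : 2 ≤ l) (hN : 0 < N) (hv : ‖v‖ ≤ ρ / (8 * l) / α / 2)
    (hw : ‖w‖ ≤ ρ) (hατ : α ^ 2 * τ ≤ ρ ^ 2 / (6000 * N * l)) :
    ∫⁻ ω, ENNReal.ofReal (Real.exp (4 * l / ρ ^ 2 *
      (α * inner ℝ (clip (X ω) (ρ / (8 * l) / α) - v) w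
        + α ^ 2 * ‖clip (X ω) (ρ / (8 * l) / α) - v‖ ^ 2))) ∂μ
      ≤ ENNReal.ofReal (Real.exp (l / (100 * N))) := by
  have hl0 : 0 < l := by linarith
  set Q : ℝ := 38 * l ^ 2 / ρ ^ 2 * α ^ 2 with hQ
  set F : Ω → ℝ := fun ω => 1 + 4 * l / ρ ^ 2 * α * inner ℝ (X ω - v) w + Q * ‖X ω - v‖ ^ 2 with hF
  have key := fun ω => exp_clip_error_le (g := X ω) hα hρ hl hv hw
  have hXv' : Integrable (fun ω => X ω - v) μ := hX.sub (integrable_const v)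
  have hin : Integrable (fun ω => inner ℝ (X ω - v) w) μ := hXv'.inner_const w
  have hlinint : Integrable (fun ω => 1 + 4 * l / ρ ^ 2 * α * inner ℝ (X ω - v) w) μ :=
    (integrable_const _).add (hin.const_mul _)
  have hFint : Integrable F μ := hlinint.add (hX2.const_mul _)
  have hin0 : ∫ ω, inner ℝ (X ω - v) w ∂μ = 0 := by
    simp_rw [real_inner_comm w]
    rw [integral_inner hXv', integral_sub hX (integrable_const v), hXv]
    simp
  have hFI : ∫ ω, F ω ∂μ ≤ Real.exp (l / (100 * N)) := by
    have : ∫ ω, F ω ∂μ = 1 + Q * ∫ ω, ‖X ω - v‖ ^ 2 ∂μ := by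
      simp only [hF]
      rw [integral_add hlinint (hX2.const_mul _),
        integral_add (integrable_const _) (hin.const_mul _), integral_const_mul, hin0,
        integral_const_mul]
      simp
    rw [this]
    have h1 : Q * ∫ ω, ‖X ω - v‖ ^ 2 ∂μ ≤ l / (100 * N) := by
      calc _ ≤ Q * τ := by gcongr
        _ = 38 * l ^ 2 / ρ ^ 2 * (α ^ 2 * τ) := by rw [hQ]; ring
        _ ≤ 38 * l ^ 2 / ρ ^ 2 * (ρ ^ 2 / (6000 * N * l)) := by gcongr
        _ = 38 / 60 * (l / (100 * N)) := by field_simp; norm_num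
        _ ≤ l / (100 * N) := by
          have : 0 ≤ l / (100 * N) := by positivity
          linarith
    linarith [Real.add_one_le_exp (l / (100 * N))]
  calc _ ≤ ∫⁻ ω, ENNReal.ofReal (F ω) ∂μ :=
        lintegral_mono fun ω => ENNReal.ofReal_le_ofReal (key ω)
    _ = ENNReal.ofReal (∫ ω, F ω ∂μ) :=
        (ofReal_integral_eq_lintegral_ofReal hFint
          (Filter.Eventually.of_forall fun ω => (Real.exp_pos _).le.trans (key ω))).symm
    _ ≤ _ := ENNReal.ofReal_le_ofReal hFI

end Moments
-- Measurability of the iterates and of the stopped noise.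
section Measurability

variable {n : ℕ} {Ξ : Type u} [MeasurableSpace Ξ] {f : E n → ℝ} {G : E n → Ξ → E n}
  {a L B b ρ : ℝ} {m : ℕ → ℕ} {x0 xs : E n}

lemma measurable_gradient (f : E n → ℝ) : Measurable (gradient f) :=
  (InnerProductSpace.toDual ℝ (E n)).symm.continuous.measurable.comp (measurable_fderiv ℝ f)

lemma measurable_clip (lam : ℝ) : Measurable fun g : E n => clip g lam := by
  unfold clip; fun_prop

lemma measurable_extrapolation (a L : ℝ) (k : ℕ) :
    Measurable (extrapolation (n := n) a L k) := by
  unfold extrapolation; fun_prop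

lemma measurable_miniBatch (hG : Measurable (Function.uncurry G)) (m : ℕ) :
    Measurable fun q : E n × (ℕ → Ξ) => miniBatch G q.1 m q.2 := by
  unfold miniBatch
  have h : ∀ i : ℕ, Measurable fun q : E n × (ℕ → Ξ) => G q.1 (q.2 i) := fun i =>
    hG.comp (measurable_fst.prodMk ((measurable_pi_apply i).comp measurable_snd))
  exact (Finset.measurable_fun_sum (Finset.range m) fun i _ => h i).const_smul (m : ℝ)⁻¹

lemma measurable_clip_miniBatch (hG : Measurable (Function.uncurry G)) (k : ℕ) :
    Measurable fun q : (E n × E n) × (ℕ → Ξ) =>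
      clip (miniBatch G (extrapolation a L k q.1) (m k) q.2) (B / alpha a L (k + 1)) :=
  (measurable_clip _).comp ((measurable_miniBatch hG (m k)).comp
    (((measurable_extrapolation a L k).comp measurable_fst).prodMk measurable_snd))

lemma measurable_noise (hG : Measurable (Function.uncurry G)) (k : ℕ) :
    Measurable fun q : (E n × E n) × (ℕ → Ξ) => noise f G a L B m xs k q.1 q.2 := by
  have h := (measurable_clip_miniBatch (a := a) (L := L) (B := B) (m := m) hG k).sub
    ((measurable_gradient f).comp ((measurable_extrapolation a L k).comp measurable_fst))
  unfold noise
  exact ((h.inner (measurable_const.sub (measurable_snd.comp measurable_fst))).const_mul _).add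
    ((h.norm.pow_const 2).const_mul _)

lemma measurableSet_inRegion (hf : Measurable f) (k : ℕ) :
    MeasurableSet {p | InRegion f a L ρ xs k p} := by
  have h1 : MeasurableSet {p : E n × E n | ‖p.2 - xs‖ ≤ ρ} :=
    measurableSet_le (measurable_snd.sub_const xs).norm measurable_const
  have h2 : MeasurableSet {p : E n × E n | ‖p.1 - xs‖ ≤ ρ} :=
    measurableSet_le (measurable_fst.sub_const xs).norm measurable_const
  have h3 : MeasurableSet {p : E n × E n | bigA a L k * (f p.1 - f xs) ≤ ρ ^ 2 / 2} :=
    measurableSet_le (((hf.comp measurable_fst).sub_const _).const_mul _) measurable_const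
  exact h1.inter (h2.inter h3)

lemma measurable_gatedNoise (hf : Measurable f) (hG : Measurable (Function.uncurry G)) (k : ℕ) :
    Measurable fun q : ((E n × E n) × ℝ) × (ℕ → Ξ) =>
      gatedNoise f G a L B m xs ρ b k q.1 q.2 := by
  have h1 : MeasurableSet {q : ((E n × E n) × ℝ) × (ℕ → Ξ) | q.1.2 ≤ b} :=
    measurableSet_le measurable_fst.snd measurable_const
  have h2 : MeasurableSet {q : ((E n × E n) × ℝ) × (ℕ → Ξ) | InRegion f a L ρ xs k q.1.1} :=
    measurable_fst.fst (measurableSet_inRegion hf k)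
  have hq : Measurable fun q : ((E n × E n) × ℝ) × (ℕ → Ξ) => (q.1.1, q.2) :=
    measurable_fst.fst.prodMk measurable_snd
  have h3 := (measurable_noise (f := f) (a := a) (L := L) (B := B) (m := m) (xs := xs) hG k).comp hq
  unfold gatedNoise
  exact Measurable.ite (h1.inter h2) h3 measurable_const

/-- The state after `k` iterations is a measurable function of the samples drawn so far. -/
lemma measurable_state {Ω : Type*} [MeasurableSpace Ω] (hf : Measurable f)
    (hG : Measurable (Function.uncurry G)) {s : Ω → ℕ → ℕ → Ξ} (k : ℕ)
    (hs : ∀ j < k, Measurable fun ω => s ω j) :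
    Measurable fun ω =>
      (iterates G a L B m x0 (s ω) k, stoppedNoise f G a L B m x0 xs ρ b (s ω) k) := by
  induction k with
  | zero => simp only [iterates, stoppedNoise]; exact measurable_const
  | succ k ih =>
    have ih := ih fun j hj => hs j (hj.trans k.lt_succ_self)
    have hk := hs k k.lt_succ_self
    have hit := ih.fst
    refine Measurable.prodMk ?_ ?_
    · simp only [iterates_succ]
      have hz := hit.snd.sub
        (((measurable_clip_miniBatch (a := a) (L := L) (B := B) (m := m) hG k).comp
          (hit.prodMk hk)).const_smul (alpha a L (k + 1)))
      exact ((measurable_extrapolation a L k).comp (hit.fst.prodMk hz)).prodMk hz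
    · simp only [stoppedNoise]
      exact ih.snd.add ((measurable_gatedNoise hf hG k).comp (ih.prodMk hk))

end Measurability

/-! ### Fresh samples are independent of the past. -/

section Independence

variable {Ω : Type v} [MeasurableSpace Ω] {μ : Measure Ω}

/-- The joint law is a product, so Tonelli allows freezing the value of X and bounding the inner
integral over Y. This plays the role of conditional expectation. -/
lemma lintegral_mul_le_of_indepFun [IsProbabilityMeasure μ] {S T : Type*}
    [MeasurableSpace S] [MeasurableSpace T]
    {X : Ω → S} {Y : Ω → T} (hX : Measurable X) (hY : Measurable Y) (hXY : IndepFun X Y μ)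
    {u : S → ENNReal} (hu : Measurable u) {h : S → T → ENNReal}
    (hh : Measurable (Function.uncurry h)) {c : ENNReal} (hc : ∀ x, ∫⁻ ω, h x (Y ω) ∂μ ≤ c) :
    ∫⁻ ω, u (X ω) * h (X ω) (Y ω) ∂μ ≤ (∫⁻ ω, u (X ω) ∂μ) * c := by
  have := Measure.isProbabilityMeasure_map (μ := μ) hX.aemeasurable
  have := Measure.isProbabilityMeasure_map (μ := μ) hY.aemeasurable
  have hF : Measurable fun q : S × T => u q.1 * h q.1 q.2 := (hu.comp measurable_fst).mul hh
  calc ∫⁻ ω, u (X ω) * h (X ω) (Y ω) ∂μ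
      = ∫⁻ q, u q.1 * h q.1 q.2 ∂(μ.map fun ω => (X ω, Y ω)) :=
        (lintegral_map hF (hX.prodMk hY)).symm
    _ = ∫⁻ x, ∫⁻ y, u x * h x y ∂(μ.map Y) ∂(μ.map X) := by
        rw [hXY.map_prod_eq_prod_map_map hX.aemeasurable hY.aemeasurable,
          lintegral_prod _ hF.aemeasurable]
    _ ≤ ∫⁻ x, u x * c ∂(μ.map X) := by
        refine lintegral_mono fun x => ?_
        have hx : Measurable (h x) := hh.comp measurable_prodMk_left
        rw [lintegral_const_mul _ hx, lintegral_map hx hY]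
        gcongr
        exact hc x
    _ = _ := by rw [lintegral_mul_const _ hu, lintegral_map hu hX]

variable {Ξ : Type u} [MeasurableSpace Ξ] {ξ : ℕ → ℕ → Ω → Ξ}

/-- Anything determined by the first `k` rows of an independent array is independent of row `k`. -/
lemma indepFun_row {S : Type*} [MeasurableSpace S] (hξ : ∀ k i, Measurable (ξ k i))
    (hind : iIndepFun (fun p : ℕ × ℕ => ξ p.1 p.2) μ) (k : ℕ) {X : Ω → S}
    (hX : ∀ m0 : MeasurableSpace Ω,
      (∀ j < k, Measurable[m0] fun ω i => ξ j i ω) → Measurable[m0] X) :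
    IndepFun X (fun ω i => ξ k i ω) μ := by
  let mm : ℕ × ℕ → MeasurableSpace Ω := fun p => MeasurableSpace.comap (ξ p.1 p.2) inferInstance
  have hle : ∀ p, mm p ≤ ‹MeasurableSpace Ω› := fun p => (hξ p.1 p.2).comap_le
  have hdisj : Disjoint {p : ℕ × ℕ | p.1 < k} {p : ℕ × ℕ | p.1 = k} := by
    rw [Set.disjoint_left]
    intro p hp hp'
    exact (ne_of_lt hp) hp'
  have hI := indep_iSup_of_disjoint hle hind.iIndep hdisj
  have key : ∀ (s : Set (ℕ × ℕ)) j, (∀ i, (j, i) ∈ s) →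
      Measurable[⨆ p ∈ s, mm p] fun ω i => ξ j i ω := by
    intro s j hj
    refine @measurable_pi_lambda _ _ _ (⨆ p ∈ s, mm p) _ _ fun i => ?_
    have h1 : mm (j, i) ≤ ⨆ p ∈ s, mm p := le_iSup₂_of_le (j, i) (hj i) le_rfl
    exact (comap_measurable (ξ j i)).mono h1 le_rfl
  rw [IndepFun_iff_Indep]
  refine indep_of_indep_of_le_left (indep_of_indep_of_le_right hI ?_) ?_
  · exact (key _ k fun _ => rfl).comap_le
  -- The σ-algebra m0 is taken to be the one generated by the rows before k.
  · exact (hX _ fun j hj => key _ j fun _ => hj).comap_le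

end Independence

/-! ### Exponential moments of the stopped noise and Markov's inequality. -/

section Concentration

variable {n : ℕ} {Ξ : Type u} [MeasurableSpace Ξ] {D : Measure Ξ} {Ω : Type v} [MeasurableSpace Ω]
  {μ : Measure Ω} [IsProbabilityMeasure μ] {f : E n → ℝ} {G : E n → Ξ → E n}
  {ξ : ℕ → ℕ → Ω → Ξ} {a L b l ρ σ : ℝ} {m : ℕ → ℕ} {x0 xs : E n}

/-- The bound must hold for every fixed state q, reachable or not. This is why the gate tests the
region, although along the trajectory `energy_le` makes that test automatic. -/
lemma lintegral_exp_gatedNoise_le (hf : IsSmooth L f) (hxs : ∀ x, f xs ≤ f x) (hL : 0 < L)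
    (hl : 2 ≤ l) (hρ : 0 < ρ) (ha : 36 * (2 * l + Real.sqrt (4 * l ^ 2 + 2 * l)) ^ 2 ≤ a)
    (hG : IsStochasticGradient D f G σ) (hξ : ∀ k i, Measurable (ξ k i))
    (hD : ∀ k i, μ.map (ξ k i) = D) (hind : iIndepFun (fun p : ℕ × ℕ => ξ p.1 p.2) μ)
    {N k : ℕ} (hN : 0 < N) (hm0 : 0 < m k)
    (hm : alpha a L (k + 1) ^ 2 * (σ ^ 2 / m k) ≤ ρ ^ 2 / (6000 * N * l))
    (q : (E n × E n) × ℝ) :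
    ∫⁻ ω, ENNReal.ofReal (Real.exp (4 * l / ρ ^ 2 *
      gatedNoise f G a L (ρ / (8 * l)) m xs ρ b k q (fun i => ξ k i ω))) ∂μ
      ≤ ENNReal.ofReal (Real.exp (l / (100 * N))) := by
  have ha0 : 0 < a := lt_of_lt_of_le (by positivity) ha
  by_cases hq : q.2 ≤ b ∧ InRegion f a L ρ xs k q.1
  · simp only [gatedNoise, if_pos hq]
    obtain ⟨h1, h2, h3, h4⟩ := miniBatch_moments hG (hξ k) (hD k)
      (fun i j hij => hind.indepFun (i := (k, i)) (j := (k, j)) (by simpa using hij))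
      (extrapolation a L k q.1) hm0
    refine lintegral_exp_clip_error_le h1 h2 h3 h4 (alpha_succ_pos ha0 hL k) hρ hl
      (by positivity) (norm_gradient_extrapolation_le hf hxs hL hl hρ.le ha hq.2) ?_ hm
    rw [norm_sub_rev]
    exact hq.2.1
  · simp only [gatedNoise, if_neg hq]
    simp only [mul_zero, Real.exp_zero, ENNReal.ofReal_one, lintegral_const, measure_univ, mul_one]
    rw [ENNReal.one_le_ofReal]
    exact Real.one_le_exp (by positivity)

/-- Supermartingale argument: given the past, the fresh row contributes one more factor
exp(l/(100N)). -/
lemma lintegral_exp_stoppedNoise_le (hf : IsSmooth L f) (hxs : ∀ x, f xs ≤ f x) (hL : 0 < L)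
    (hl : 2 ≤ l) (hρ : 0 < ρ) (ha : 36 * (2 * l + Real.sqrt (4 * l ^ 2 + 2 * l)) ^ 2 ≤ a)
    (hG : IsStochasticGradient D f G σ) (hξ : ∀ k i, Measurable (ξ k i))
    (hD : ∀ k i, μ.map (ξ k i) = D) (hind : iIndepFun (fun p : ℕ × ℕ => ξ p.1 p.2) μ)
    {N : ℕ} (hN : 0 < N) (hm0 : ∀ k, 0 < m k)
    (hm : ∀ k, alpha a L (k + 1) ^ 2 * (σ ^ 2 / m k) ≤ ρ ^ 2 / (6000 * N * l)) (k : ℕ) :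
    ∫⁻ ω, ENNReal.ofReal (Real.exp (4 * l / ρ ^ 2 *
      stoppedNoise f G a L (ρ / (8 * l)) m x0 xs ρ b (fun k i => ξ k i ω) k)) ∂μ
      ≤ ENNReal.ofReal (Real.exp (k * (l / (100 * N)))) := by
  have hfm : Measurable f := hf.1.continuous.measurable
  have hrow : ∀ j, Measurable fun ω i => ξ j i ω := fun j => measurable_pi_lambda _ fun i => hξ j i
  induction k with
  | zero => simp [stoppedNoise]
  | succ k ih =>
    have hstate := measurable_state (a := a) (L := L) (B := ρ / (8 * l)) (m := m) (x0 := x0)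
      (xs := xs) (ρ := ρ) (b := b) (s := fun ω k i => ξ k i ω) hfm hG.measurable k
      fun j _ => hrow j
    have hindep := indepFun_row hξ hind k fun m0 h0 =>
      @measurable_state n Ξ _ f G a L (ρ / (8 * l)) b ρ m x0 xs Ω m0 hfm hG.measurable
        (fun ω k i => ξ k i ω) k h0
    have hu : Measurable fun q : (E n × E n) × ℝ =>
        ENNReal.ofReal (Real.exp (4 * l / ρ ^ 2 * q.2)) := by fun_prop
    have hh : Measurable (Function.uncurry fun (q : (E n × E n) × ℝ) (s : ℕ → Ξ) =>
        ENNReal.ofReal (Real.exp (4 * l / ρ ^ 2 *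
          gatedNoise f G a L (ρ / (8 * l)) m xs ρ b k q s))) :=
      (((measurable_gatedNoise hfm hG.measurable k).const_mul _).exp).ennreal_ofReal
    have := lintegral_mul_le_of_indepFun hstate (hrow k) hindep hu hh
      (lintegral_exp_gatedNoise_le hf hxs hL hl hρ ha hG hξ hD hind hN (hm0 k) (hm k))
    calc _ = _ := by
          refine lintegral_congr fun ω => ?_
          rw [stoppedNoise, mul_add, Real.exp_add, ENNReal.ofReal_mul (Real.exp_pos _).le]
      _ ≤ _ := this
      _ ≤ ENNReal.ofReal (Real.exp (k * (l / (100 * N)))) *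
          ENNReal.ofReal (Real.exp (l / (100 * N))) := by gcongr
      _ = _ := by
          rw [← ENNReal.ofReal_mul (Real.exp_pos _).le, ← Real.exp_add]
          congr 2
          push_cast
          ring

/-- High-probability convergence of the method in terms of the accumulated stepsizes. -/
lemma one_sub_exp_le_measureReal (hf : IsSmooth L f) (hc : ConvexOn ℝ Set.univ f)
    (hxs : ∀ x, f xs ≤ f x) (hL : 0 < L) (hl : 2 ≤ l) (hx : x0 ≠ xs)
    (ha : 36 * (2 * l + Real.sqrt (4 * l ^ 2 + 2 * l)) ^ 2 ≤ a)
    (hG : IsStochasticGradient D f G σ) (hξ : ∀ k i, Measurable (ξ k i))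
    (hD : ∀ k i, μ.map (ξ k i) = D) (hind : iIndepFun (fun p : ℕ × ℕ => ξ p.1 p.2) μ)
    {N : ℕ} (hN : 0 < N) (hm0 : ∀ k, 0 < m k)
    (hm : ∀ k, alpha a L (k + 1) ^ 2 * (σ ^ 2 / m k)
      ≤ (Real.sqrt 5 * ‖x0 - xs‖) ^ 2 / (6000 * N * l)) :
    1 - Real.exp (-l) ≤ μ.real {ω | bigA a L N *
      (f (output G a L (Real.sqrt 5 * ‖x0 - xs‖ / (8 * l)) m x0 (fun k i => ξ k i ω) N) - f xs)
        ≤ 5 / 2 * ‖x0 - xs‖ ^ 2} := by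
  set R := ‖x0 - xs‖ with hR
  have hR0 : 0 < R := norm_pos_iff.2 (sub_ne_zero.2 hx)
  set ρ := Real.sqrt 5 * R with hρdef
  have hρ2 : ρ ^ 2 = 5 * R ^ 2 := by rw [hρdef, mul_pow, Real.sq_sqrt (by norm_num)]
  have hρ : 0 < ρ := by positivity
  set T : Ω → ℝ := fun ω =>
    stoppedNoise f G a L (ρ / (8 * l)) m x0 xs ρ (2 * R ^ 2) (fun k i => ξ k i ω) N with hT
  have hfm : Measurable f := hf.1.continuous.measurable
  have hTm : Measurable T := (measurable_state (s := fun ω k i => ξ k i ω) hfm hG.measurable N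
    fun j _ => measurable_pi_lambda _ fun i => hξ j i).snd
  have ha2 : 2 ≤ a := by
    have := Real.sqrt_nonneg (4 * l ^ 2 + 2 * l)
    nlinarith
  have hsub : {ω | 2 * R ^ 2 < T ω}ᶜ ⊆ {ω | bigA a L N *
      (f (output G a L (ρ / (8 * l)) m x0 (fun k i => ξ k i ω) N) - f xs) ≤ 5 / 2 * R ^ 2} := by
    intro ω hω
    -- The threshold b = 2R² is the largest with R² + 2b ≤ ρ² = 5R².
    have h := (energy_le hf hc hxs ha2 hL (by positivity) hρ.le (by rw [hρ2, ← hR]; linarith)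
      (fun k i => ξ k i ω) N (not_lt.1 hω)).2.2.2
    simp only [Set.mem_ofPred_eq, output]
    linarith
  have hbad : μ.real {ω | 2 * R ^ 2 < T ω} ≤ Real.exp (-l) := by
    have hexp := lintegral_exp_stoppedNoise_le (b := 2 * R ^ 2) (x0 := x0) hf hxs hL hl hρ ha hG hξ
      hD hind hN hm0 hm N
    have hN0 : (N : ℝ) ≠ 0 := by positivity
    have e1 : 4 * l / ρ ^ 2 * (2 * R ^ 2) = 8 / 5 * l := by rw [hρ2]; field_simp; norm_num
    have hmarkov := mul_meas_ge_le_lintegral (μ := μ)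
      (f := fun ω => ENNReal.ofReal (Real.exp (4 * l / ρ ^ 2 * T ω)))
      ((hTm.const_mul _).exp.ennreal_ofReal) (ENNReal.ofReal (Real.exp (8 / 5 * l)))
    have h1 : μ {ω | 2 * R ^ 2 < T ω} ≤ μ {ω | ENNReal.ofReal (Real.exp (8 / 5 * l))
        ≤ ENNReal.ofReal (Real.exp (4 * l / ρ ^ 2 * T ω))} := by
      refine measure_mono fun ω hω => ENNReal.ofReal_le_ofReal (Real.exp_le_exp.2 ?_)
      rw [← e1]
      exact mul_le_mul_of_nonneg_left (le_of_lt hω) (by positivity)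
    have h2 : ENNReal.ofReal (Real.exp (8 / 5 * l)) * μ {ω | 2 * R ^ 2 < T ω}
        ≤ ENNReal.ofReal (Real.exp (N * (l / (100 * N)))) :=
      (mul_le_mul_right h1 _).trans (hmarkov.trans hexp)
    have h3 := ENNReal.toReal_mono ENNReal.ofReal_ne_top h2
    rw [ENNReal.toReal_mul, ENNReal.toReal_ofReal (Real.exp_pos _).le,
      ENNReal.toReal_ofReal (Real.exp_pos _).le, ← measureReal_def] at h3
    have h4 : Real.exp (N * (l / (100 * N))) ≤ Real.exp (8 / 5 * l) * Real.exp (-l) := by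
      rw [← Real.exp_add, Real.exp_le_exp]
      have : N * (l / (100 * N)) = l / 100 := by field_simp
      rw [this]; linarith
    exact le_of_mul_le_mul_left (h3.trans h4) (Real.exp_pos _)
  have hms : MeasurableSet {ω | 2 * R ^ 2 < T ω} := measurableSet_lt measurable_const hTm
  calc 1 - Real.exp (-l) ≤ 1 - μ.real {ω | 2 * R ^ 2 < T ω} := by linarith
    _ = μ.real {ω | 2 * R ^ 2 < T ω}ᶜ := (probReal_compl_eq_one_sub hms).symm
    _ ≤ _ := measureReal_mono hsub

end Concentration
-- Parameter choices, batch sizes and iteration complexity.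
section Parameters

variable {L σ R β ε : ℝ} {N k : ℕ}

lemma constC_sq : constC ^ 2 = 5 := Real.sq_sqrt (by norm_num)

lemma stepParam'_le_stepParam (L σ R β : ℝ) (N : ℕ) : stepParam' β N ≤ stepParam L σ R β N :=
  le_max_left _ _

lemma sq_le_stepParam (L σ R β : ℝ) (N : ℕ) :
    36 * (2 * logFactor N β + Real.sqrt (4 * logFactor N β ^ 2 + 2 * logFactor N β)) ^ 2
      ≤ stepParam L σ R β N :=
  ((le_max_right _ _).trans (le_max_right _ _)).trans (stepParam'_le_stepParam L σ R β N)

lemma stepParam_pos (L σ R β : ℝ) (N : ℕ) : 0 < stepParam L σ R β N :=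
  (one_pos.trans_le (le_max_left _ _)).trans_le (stepParam'_le_stepParam L σ R β N)

/-- The quadratic term dominates: 36(2 + 9/4)² = 650.25. -/
lemma stepParam'_le (hl : 2 ≤ logFactor N β) : stepParam' β N ≤ 651 * logFactor N β ^ 2 := by
  unfold stepParam'
  set l := logFactor N β
  have h5 : 1 ≤ constC := Real.one_le_sqrt.2 (by norm_num)
  refine max_le (by nlinarith) (max_le ?_ ?_)
  · exact (div_le_self (by positivity) h5).trans (by nlinarith)
  · have : Real.sqrt (4 * l ^ 2 + 2 * l) ≤ 9 / 4 * l :=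
      Real.sqrt_le_iff.2 ⟨by positivity, by nlinarith⟩
    calc _ ≤ 36 * (2 * l + 9 / 4 * l) ^ 2 := by gcongr
      _ ≤ _ := by nlinarith [sq_nonneg l]

lemma rpow_three_halves (N : ℕ) : (N : ℝ) ^ (3 / 2 : ℝ) = N * Real.sqrt N := by
  rcases Nat.eq_zero_or_pos N with rfl | hN
  · simp
  · have : (0 : ℝ) < N := by exact_mod_cast hN
    rw [show (3 / 2 : ℝ) = 1 + 1 / 2 by norm_num, Real.rpow_add this, Real.rpow_one,
      Real.sqrt_eq_rpow]

lemma batchSize_pos (L σ R β : ℝ) (N k : ℕ) : 0 < batchSize L σ R β N k :=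
  Nat.ceil_pos.2 (one_pos.trans_le (le_max_left _ _))

/-- The entry with 6000 in the batch size is designed to give this variance budget per iteration. -/
lemma alpha_sq_mul_variance_le (hR : 0 < R) (hN : 0 < N) (hl : 0 < logFactor N β) (k : ℕ) :
    alpha (stepParam L σ R β N) L (k + 1) ^ 2 * (σ ^ 2 / batchSize L σ R β N k)
      ≤ (constC * R) ^ 2 / (6000 * N * logFactor N β) := by
  have hb : (0 : ℝ) < batchSize L σ R β N k := by exact_mod_cast batchSize_pos L σ R β N k
  have h := ((le_max_left _ _).trans (le_max_right _ _)).trans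
    (Nat.le_ceil (max (1 : ℝ)
    (max (6000 * σ ^ 2 * alpha (stepParam L σ R β N) L (k + 1) ^ 2 * N * logFactor N β
        / (constC ^ 2 * R ^ 2))
      (10368 * σ ^ 2 * alpha (stepParam L σ R β N) L (k + 1) ^ 2 * N
        / (constC ^ 2 * R ^ 2)))))
  change _ ≤ (batchSize L σ R β N k : ℝ) at h
  rw [constC_sq, div_le_iff₀ (by positivity)] at h
  have hN' : (0 : ℝ) < N := by exact_mod_cast hN
  rw [mul_pow, constC_sq, mul_div_assoc', div_le_div_iff₀ hb (by positivity)]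
  linarith

/-- The batch sizes are bounded by a numerical constant. -/
lemma batchSize_le (hL : 0 < L) (hσ : 0 ≤ σ) (hR : 0 < R) (hN : 1 ≤ N)
    (hl : 2 ≤ logFactor N β) (hk : k ≤ N) : (batchSize L σ R β N k : ℝ) ≤ 2701 := by
  have hN' : (1 : ℝ) ≤ N := by exact_mod_cast hN
  have hk' : (k : ℝ) ≤ N := by exact_mod_cast hk
  have ha0 := stepParam_pos L σ R β N
  have ha : σ * (N : ℝ) ^ (3 / 2 : ℝ) / (L * R) * Real.sqrt (logFactor N β)
      ≤ stepParam L σ R β N := le_max_right _ _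
  rw [rpow_three_halves, div_mul_eq_mul_div, div_le_iff₀ (by positivity)] at ha
  have hαpos := alpha_succ_pos ha0 hL k
  have hα : σ * alpha (stepParam L σ R β N) L (k + 1) * Real.sqrt N * Real.sqrt (logFactor N β)
      ≤ 3 / 2 * R := by
    rw [alpha]
    set a := stepParam L σ R β N
    calc _ = (σ * (k + 2) * Real.sqrt N * Real.sqrt (logFactor N β)) / (2 * a * L) := by
          field_simp
      -- k + 2 ≤ 3N since k ≤ N and N ≥ 1.
      _ ≤ (σ * (3 * N) * Real.sqrt N * Real.sqrt (logFactor N β)) / (2 * a * L) := by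
          gcongr; linarith
      _ = 3 * (σ * (N * Real.sqrt N) * Real.sqrt (logFactor N β)) / (2 * a * L) := by ring
      _ ≤ 3 * (a * (L * R)) / (2 * a * L) := by gcongr
      _ = 3 / 2 * R := by field_simp
  set α := alpha (stepParam L σ R β N) L (k + 1) with hαdef
  have hsq : σ ^ 2 * α ^ 2 * N * logFactor N β ≤ 9 / 4 * R ^ 2 := by
    have := pow_le_pow_left₀ (by positivity) hα 2
    rw [mul_pow, mul_pow, mul_pow, Real.sq_sqrt (by positivity), Real.sq_sqrt (by linarith)] at this
    linarith
  -- 6000·(9/4)/5 = 2700; rounding up accounts for the final 2701.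
  have h1 : 6000 * σ ^ 2 * α ^ 2 * N * logFactor N β / (constC ^ 2 * R ^ 2) ≤ 2700 := by
    rw [constC_sq, div_le_iff₀ (by positivity)]
    linarith
  have h2 : 10368 * σ ^ 2 * α ^ 2 * N / (constC ^ 2 * R ^ 2) ≤ 2700 := by
    rw [constC_sq, div_le_iff₀ (by positivity)]
    have := mul_le_mul_of_nonneg_left hl (by positivity : 0 ≤ σ ^ 2 * α ^ 2 * N)
    nlinarith
  rw [batchSize, ← hαdef]
  have h3 := max_le (by norm_num : (1 : ℝ) ≤ 2700) (max_le h1 h2)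
  have h4 := (Nat.ceil_lt_add_one (zero_le_one.trans (le_max_left (1 : ℝ)
    (max (6000 * σ ^ 2 * α ^ 2 * N * logFactor N β / (constC ^ 2 * R ^ 2))
      (10368 * σ ^ 2 * α ^ 2 * N / (constC ^ 2 * R ^ 2)))))).le
  linarith

/-- Sufficient number of iterations for accuracy `ε`. -/
lemma le_of_bigA_mul_le (hL : 0 < L) (hR : 0 < R) (hε : 0 < ε) (hN : 1 ≤ N)
    (hl : 2 ≤ logFactor N β)
    (h : 100 * max (Real.sqrt (L * R ^ 2 / ε)) (σ ^ 2 * R ^ 2 / ε ^ 2) * logFactor N β ≤ N)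
    {Δ : ℝ} (hΔ : bigA (stepParam L σ R β N) L N * Δ ≤ 5 / 2 * R ^ 2) : Δ ≤ ε := by
  by_contra! hlt
  have ha0 := stepParam_pos L σ R β N
  have hN' : (1 : ℝ) ≤ N := by exact_mod_cast hN
  have hN0 : (0 : ℝ) < N := by linarith
  set l := logFactor N β
  -- With A_N = N(N+3)/(4aL), this turns the energy bound into accuracy ε. Each of the two entries
  -- of the maximum defining a is handled by one entry of the maximum in h.
  have key : 10 * stepParam L σ R β N * L * R ^ 2 ≤ ε * N ^ 2 := by
    rw [← le_div_iff₀ (by positivity), mul_assoc, mul_comm (10 : ℝ), mul_assoc,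
      ← le_div_iff₀ (by positivity)]
    refine max_le ((stepParam'_le hl).trans ?_) ?_
    · have h1 : 100 * Real.sqrt (L * R ^ 2 / ε) * l ≤ N := by
        refine le_trans ?_ h
        gcongr
        exact le_max_left _ _
      have h2 := pow_le_pow_left₀ (by positivity) h1 2
      rw [mul_pow, mul_pow, Real.sq_sqrt (by positivity)] at h2
      rw [le_div_iff₀ (by positivity), le_div_iff₀ (by positivity)]
      have h3 : 100 ^ 2 * (L * R ^ 2 / ε) * l ^ 2 * ε = 100 ^ 2 * (L * R ^ 2 * l ^ 2) := by
        field_simp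
      have h4 := mul_le_mul_of_nonneg_right h2 hε.le
      have h5 : 0 ≤ L * R ^ 2 * l ^ 2 := by positivity
      nlinarith
    · have h1 : 100 * (σ ^ 2 * R ^ 2 / ε ^ 2) * l ≤ N := by
        refine le_trans ?_ h
        gcongr
        exact le_max_right _ _
      have h2 : 10 * (σ * R) * Real.sqrt l ≤ ε * Real.sqrt N := by
        refine le_of_sq_le_sq ?_ (by positivity)
        rw [mul_pow, mul_pow, mul_pow, mul_pow, Real.sq_sqrt hN0.le, Real.sq_sqrt (by linarith)]
        have h3 := mul_le_mul_of_nonneg_left h1 (sq_nonneg ε)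
        have e : ε ^ 2 * (100 * (σ ^ 2 * R ^ 2 / ε ^ 2) * l) = 100 * (σ ^ 2 * R ^ 2) * l := by
          field_simp
        linarith
      rw [rpow_three_halves, le_div_iff₀ (by positivity), le_div_iff₀ (by positivity)]
      calc _ = 10 * (σ * R) * Real.sqrt l * (N * Real.sqrt N) := by field_simp; rfl
        _ ≤ ε * Real.sqrt N * (N * Real.sqrt N) := by gcongr
        _ = ε * (Real.sqrt N ^ 2) * N := by ring
        _ = _ := by rw [Real.sq_sqrt hN0.le]; ring
  rw [bigA_eq, div_mul_eq_mul_div, div_le_iff₀ (by positivity)] at hΔ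
  have h1 : (N : ℝ) * (N + 3) * ε ≤ N * (N + 3) * Δ := by gcongr
  nlinarith

/-- The implicit condition `N ≥ 100 M ln (4 N / β)` holds as soon as `N` is of the order of
`max {1, M ln ((q + s) / β)}`. -/
lemma mul_log_le_of_le {q s x : ℝ} (hq : 0 < q) (hs : 0 ≤ s) (hβ : 0 < β) (hβ1 : β < 1)
    (hx : 20000 * max 1 (max (Real.sqrt q) (s ^ 2) * Real.log ((q + s) / β)) ≤ x) :
    100 * max (Real.sqrt q) (s ^ 2) * Real.log (4 * x / β) ≤ x := by
  set M := max (Real.sqrt q) (s ^ 2) with hM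
  set Λ := Real.log ((q + s) / β) with hΛ
  set t := q + s with ht
  have ht0 : 0 < t := by positivity
  have hM0 : 0 < M := lt_max_of_lt_left (Real.sqrt_pos.2 hq)
  have hx1 : 20000 ≤ x := by linarith [le_max_left 1 (M * Λ)]
  have hx0 : 0 < x := by linarith
  have hxΛ : 20000 * (M * Λ) ≤ x := by linarith [le_max_right 1 (M * Λ)]
  -- The term in x/(200M) is absorbed into x/2 by log y ≤ y; what remains no longer depends on x.
  have hsplit : Real.log (4 * x / β) = Real.log (x / (200 * M)) + Real.log 800
      + Real.log (M / t) + Λ := by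
    rw [hΛ, ← Real.log_mul (by positivity) (by norm_num),
      ← Real.log_mul (by positivity) (by positivity),
      ← Real.log_mul (by positivity) (by positivity)]
    congr 1
    field_simp
    norm_num
  have h1 : 100 * M * Real.log (x / (200 * M)) ≤ x / 2 := by
    have : Real.log (x / (200 * M)) ≤ x / (200 * M) := Real.log_le_self (by positivity)
    calc _ ≤ 100 * M * (x / (200 * M)) := by gcongr
      _ = x / 2 := by field_simp; norm_num
  have h800 : Real.log 800 ≤ 7 := by
    rw [Real.log_le_iff_le_exp (by norm_num)]
    have h := Real.exp_one_gt_d9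
    have : Real.exp 7 = Real.exp 1 ^ 7 := by rw [← Real.exp_nat_mul]; norm_num
    rw [this]
    calc (800 : ℝ) ≤ 2.7 ^ 7 := by norm_num
      _ ≤ Real.exp 1 ^ 7 := by gcongr; linarith
  have hsq : Real.sqrt q ≤ Real.sqrt t := Real.sqrt_le_sqrt (by linarith)
  have hst : s ^ 2 ≤ t ^ 2 := by gcongr; linarith
  suffices h : M * 7 + M * Real.log (M / t) + M * Λ ≤ x / 200 by
    rw [hsplit]
    have := mul_le_mul_of_nonneg_left h800 hM0.le
    nlinarith
  -- For t ≥ e one has M ≤ t², so log(M/t) ≤ log t ≤ Λ and 1 ≤ Λ. For t < e, Λ may be small or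
  -- negative, but M and M·log(M/t) are bounded by constants, covered by x ≥ 20000.
  rcases le_or_gt (Real.exp 1) t with he | he
  · have ht1 : 1 ≤ t := (Real.one_le_exp zero_le_one).trans he
    have hMt : M ≤ t ^ 2 := by
      refine max_le (hsq.trans ?_) hst
      exact Real.sqrt_le_iff.2
        ⟨by positivity, by nlinarith [pow_le_pow_right₀ ht1 (show 1 ≤ 4 by norm_num)]⟩
    have hlogt : 1 ≤ Real.log t := (Real.le_log_iff_exp_le ht0).2 he
    have hΛt : Real.log t ≤ Λ := by
      rw [hΛ, Real.log_div ht0.ne' hβ.ne']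
      linarith [Real.log_nonpos hβ.le hβ1.le]
    have hMlog : Real.log (M / t) ≤ Real.log t :=
      Real.log_le_log (by positivity) (by rw [div_le_iff₀ ht0]; linarith)
    have h4 : M * Real.log (M / t) ≤ M * Λ := by gcongr; linarith
    have h5 : M * 1 ≤ M * Λ := by gcongr; linarith
    linarith
  · have h3 : t < 3 := he.trans (Real.exp_one_lt_d9.trans (by norm_num))
    have hM9 : M ≤ 9 := by
      refine max_le (hsq.trans ?_) (hst.trans (by nlinarith))
      exact Real.sqrt_le_iff.2 ⟨by norm_num, by linarith⟩
    have hM2 : M * (M / t) ≤ 27 := by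
      rw [mul_div_assoc', div_le_iff₀ ht0]
      rcases max_choice (Real.sqrt q) (s ^ 2) with h | h
      · rw [hM, h, Real.mul_self_sqrt hq.le]; linarith
      · rw [hM, h]
        have : s ≤ t := by linarith
        calc s ^ 2 * s ^ 2 ≤ t ^ 2 * t ^ 2 := by gcongr
          _ = t ^ 3 * t := by ring
          _ ≤ 3 ^ 3 * t := by gcongr
          _ = _ := by norm_num
    have h4 : M * Real.log (M / t) ≤ 27 :=
      (mul_le_mul_of_nonneg_left (Real.log_le_self (by positivity)) hM0.le).trans hM2
    linarith

lemma two_le_logFactor (hβ : 0 < β) (hβ1 : β < 1) (hN : 2 ≤ N) : 2 ≤ logFactor N β := by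
  have hN' : (2 : ℝ) ≤ N := by exact_mod_cast hN
  rw [logFactor, Real.le_log_iff_exp_le (by positivity)]
  have h := Real.exp_one_lt_d9
  have : Real.exp 2 = Real.exp 1 ^ 2 := by rw [← Real.exp_nat_mul]; norm_num
  rw [this, le_div_iff₀ hβ]
  have h0 := Real.exp_pos 1
  calc Real.exp 1 ^ 2 * β ≤ Real.exp 1 ^ 2 * 1 := by gcongr
    _ ≤ 2.8 ^ 2 * 1 := by gcongr; linarith
    _ ≤ 4 * N := by linarith

lemma exp_neg_logFactor_le (hβ : 0 < β) (hN : 1 ≤ N) : Real.exp (-logFactor N β) ≤ β := by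
  have hN' : (1 : ℝ) ≤ N := by exact_mod_cast hN
  rw [Real.exp_neg, logFactor, Real.exp_log (by positivity), inv_div, div_le_iff₀ (by positivity)]
  nlinarith

end Parameters
end ClippedSSTM

/-! ### Assembly of the theorem. -/

open ClippedSSTM

theorem mainTheorem3 :
    -- a single numerical constant `K` for all problems, dimensions and parameters
    ∃ K : ℝ, 0 < K ∧
      ∀ (n : ℕ) (Ξ : Type u) [MeasurableSpace Ξ] (D : Measure Ξ) [IsProbabilityMeasure D]
        (Ω : Type v) [MeasurableSpace Ω] (μ : Measure Ω) [IsProbabilityMeasure μ]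
        (f : ClippedSSTM.E n → ℝ) (G : ClippedSSTM.E n → Ξ → ClippedSSTM.E n)
        (ξ : ℕ → ℕ → Ω → Ξ) (L σ β : ℝ) (x0 xs : ClippedSSTM.E n),
        0 < L → 0 ≤ σ → 0 < β → β < 1 →
        ConvexOn ℝ Set.univ f →
        ClippedSSTM.IsSmooth L f →
        (∀ x, f xs ≤ f x) →
        x0 ≠ xs →
        ClippedSSTM.IsStochasticGradient D f G σ →
        -- the samples `ξ k i` are independent with common distribution `D`
        (∀ k i, Measurable (ξ k i)) →
        (∀ k i, μ.map (ξ k i) = D) →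
        iIndepFun (fun p : ℕ × ℕ => ξ p.1 p.2) μ →
        -- the batch sizes are bounded by a numerical constant
        (∀ N : ℕ, 1 ≤ N → 2 ≤ Real.log (4 * N / β) →
          ∀ k ≤ N, (ClippedSSTM.batchSize L σ ‖x0 - xs‖ β N k : ℝ) ≤ K) ∧
        -- iteration and oracle complexity of reaching accuracy `ε` with probability `≥ 1 - β`
        (∀ ε : ℝ, 0 < ε →
          ∃ N₀ : ℕ, 1 ≤ N₀ ∧ 2 ≤ Real.log (4 * N₀ / β) ∧
            (N₀ : ℝ) ≤ K * max 1 (ClippedSSTM.complexity L σ ‖x0 - xs‖ β ε) ∧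
            ((∑ k ∈ Finset.range N₀, ClippedSSTM.batchSize L σ ‖x0 - xs‖ β N₀ k : ℕ) : ℝ)
              ≤ K * max 1 (ClippedSSTM.complexity L σ ‖x0 - xs‖ β ε) ∧
            ∀ N : ℕ, N₀ ≤ N →
              1 - β ≤ μ.real {ω |
                f (ClippedSSTM.output G (ClippedSSTM.stepParam L σ ‖x0 - xs‖ β N) L
                    (ClippedSSTM.clipParam ‖x0 - xs‖ β N)
                    (ClippedSSTM.batchSize L σ ‖x0 - xs‖ β N) x0
                    (fun k i => ξ k i ω) N) - f xs ≤ ε}) := by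
  -- Batch bound times the bound N₀ ≤ 20001·V, the extra V paying for the rounding in N₀.
  refine ⟨2701 * 20001, by norm_num, ?_⟩
  intro n Ξ _ D _ Ω _ μ _ f G ξ L σ β x0 xs hL hσ hβ hβ1 hc hf hxs hx hG hξ hD hind
  have hR : 0 < ‖x0 - xs‖ := norm_pos_iff.2 (sub_ne_zero.2 hx)
  set R := ‖x0 - xs‖ with hRdef
  refine ⟨fun N hN hl k hk => (batchSize_le hL hσ hR hN hl hk).trans (by norm_num), ?_⟩
  intro ε hε
  set V := max 1 (complexity L σ R β ε) with hV
  have hV1 : 1 ≤ V := le_max_left _ _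
  set N₀ := ⌈20000 * V⌉₊ with hN₀
  have hceil : 20000 * V ≤ N₀ := Nat.le_ceil _
  have hceil' : (N₀ : ℝ) ≤ 20001 * V := by
    have := (Nat.ceil_lt_add_one (by positivity : 0 ≤ 20000 * V)).le
    linarith
  have hN₀2 : 2 ≤ N₀ := by
    have : (2 : ℝ) ≤ N₀ := by linarith
    exact_mod_cast this
  have hl₀ := two_le_logFactor hβ hβ1 hN₀2
  refine ⟨N₀, by omega, hl₀, by linarith, ?_, ?_⟩
  · push_cast
    calc _ ≤ ∑ k ∈ Finset.range N₀, (2701 : ℝ) := Finset.sum_le_sum fun k hk =>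
          batchSize_le hL hσ hR (by omega) hl₀ (Finset.mem_range.1 hk).le
      _ = N₀ * 2701 := by rw [Finset.sum_const, Finset.card_range, nsmul_eq_mul]
      _ ≤ _ := by linarith
  · intro N hN
    have hl := two_le_logFactor hβ hβ1 (hN₀2.trans hN)
    have hN1 : 1 ≤ N := by omega
    have hNN : (N₀ : ℝ) ≤ N := by exact_mod_cast hN
    have hprob := one_sub_exp_le_measureReal hf hc hxs hL hl hx (sq_le_stepParam L σ R β N) hG hξ
      hD hind hN1 (batchSize_pos L σ R β N)
      (alpha_sq_mul_variance_le (L := L) (σ := σ) hR hN1 (by linarith))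
    have hlarge : 100 * max (Real.sqrt (L * R ^ 2 / ε)) (σ ^ 2 * R ^ 2 / ε ^ 2) * logFactor N β
        ≤ N := by
      have e1 : σ ^ 2 * R ^ 2 / ε ^ 2 = (σ * R / ε) ^ 2 := by rw [div_pow, mul_pow]
      have e2 : (L * R ^ 2 + σ * R) / (ε * β) = (L * R ^ 2 / ε + σ * R / ε) / β := by
        field_simp
      rw [e1]
      -- Applied with q = LR²/ε, s = σR/ε and x = N; since only a lower bound on x is needed, every
      -- N ≥ N₀ is covered.
      refine mul_log_le_of_le (by positivity) (by positivity) hβ hβ1 ?_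
      rw [← e1, ← e2]
      exact hceil.trans hNN
    calc 1 - β ≤ 1 - Real.exp (-logFactor N β) := by linarith [exp_neg_logFactor_le hβ hN1]
      _ ≤ _ := hprob
      _ ≤ _ := measureReal_mono fun ω hω =>
          le_of_bigA_mul_le hL hR hε hN1 hl hlarge hω
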